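/- Let $X,U$ be finite-dimensional real Hilbert spaces, $\Theta$ an open subset of a finite-dimensional Euclidean space $T$, $Y$ a set of observations and $y\in Y$ fixed. Let $K:X\to U$ be linear, and let $H(\cdot,y,\theta):X\to\mathbb R\cup\{+\infty\}$ and $G(\cdot,y,\theta):U\to\mathbb R\cup\{+\infty\}$ be proper, closed and convex for every $\theta\in\Theta$. Write $\operatorname{Prox}_f(x)=\operatorname{argmin}_z \tfrac12\|z-x\|^2+f(z)$ and $f^*(u)=\sup_z\langle z,u\rangle-f(z)$; let $\operatorname{Prox}_{\xi H}(x,y,\theta)$ denote $\operatorname{Prox}_{\xi H(\cdot,y,\theta)}(x)$, and $\operatorname{Prox}_{\tau G^*}(u,y,\theta)$ denote $\operatorname{Prox}_{\tau (G(\cdot,y,\theta))^*}(u)$. Let $\tau,\xi>0$ and $\zeta\in\mathbb R$. From an initial point $a^{(0)}(y,\theta)\in X\times X\times U$, the Chambolle–Pock primal–dual algorithm computes $a^{(\ell)}=(x^{(\ell)},\tilde x^{(\ell)},u^{(\ell)})$ by $a^{(\ell+1)}=\psi(a^{(\ell)},y,\theta)$, that is, $$u^{(\ell+1)}=\operatorname{Prox}_{\tau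 G^*}(U^{(\ell)},y,\theta),\quad U^{(\ell)}=u^{(\ell)}+\tau K\tilde x^{(\ell)},$$ $$x^{(\ell+1)}=\operatorname{Prox}_{\xi H}(X^{(\ell)},y,\theta),\quad X^{(\ell)}=x^{(\ell)}-\xi K^*u^{(\ell+1)},$$ $$\tilde x^{(\ell+1)}=x^{(\ell+1)}+\zeta(x^{(\ell+1)}-x^{(\ell)}),$$ with output $x^{(\ell)}=\gamma(a^{(\ell)})$, where $\gamma(x,\tilde x,u)=x$. Assume that $\theta\mapsto\psi(a,y,\theta)$ is Lipschitz on $\Theta$ with a constant independent of $a$, and that $\theta\mapsto a^{(0)}(y,\theta)$ is Lipschitz on $\Theta$. Then all the iterates $\theta\mapsto a^{(\ell)},x^{(\ell)},\tilde x^{(\ell)},u^{(\ell)}$ are weakly differentiable on $\Theta$. Moreover, there are versions $J_\psi=(\partial_1\psi,\partial_3\psi)$, $J_G=(\partial_1\operatorname{Prox}_{\tau G^*},\partial_3\operatorname{Prox}_{\tau G^*})$ and $J_H=(\partial_1\operatorname{Prox}_{\xi H},\partial_3\operatorname{Prox}_{\xi H})$ of the weak Jacobians on $(X\times X\times U)\times\Theta$,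 $U\times\Theta$ and $X\times\Theta$ of the maps $(a,\theta)\mapsto\psi(a,y,\theta)$, $(u,\theta)\mapsto\operatorname{Prox}_{\tau G^*}(u,y,\theta)$ and $(x,\theta)\mapsto\operatorname{Prox}_{\xi H}(x,y,\theta)$, each equal to the Fréchet derivative at every point where the map is differentiable and with values everywhere in Clarke's generalized Jacobian (the convex hull of the limits of derivatives at nearby points of differentiability), with the following property. For any weak Jacobians $J_a^{(\ell)},J_x^{(\ell)},J_{\tilde x}^{(\ell)},J_u^{(\ell)}$ with respect to $\theta$ of $a^{(\ell)},x^{(\ell)},\tilde x^{(\ell)},u^{(\ell)}$, every $\ell\ge0$ and almost every $\theta\in\Theta$, $$J_x^{(\ell)}=\Gamma_a^{(\ell)}J_a^{(\ell)},\qquad J_a^{(\ell+1)}=\Psi_a^{(\ell)}J_a^{(\ell)}+\Psi_\theta^{(\ell)},$$ $$J_u^{(\ell+1)}=\mathcal G_u^{(\ell)}\bigl(J_u^{(\ell)}+\tau KJ_{\tilde x}^{(\ell)}\bigr)+\mathcal G_\theta^{(\ell)},$$ $$J_x^{(\ell+1)}=\mathcal H_x^{(\ell)}\bigl(J_x^{(\ell)}-\xi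 K^*J_u^{(\ell+1)}\bigr)+\mathcal H_\theta^{(\ell)},$$ $$J_{\tilde x}^{(\ell+1)}=J_x^{(\ell+1)}+\zeta\bigl(J_x^{(\ell+1)}-J_x^{(\ell)}\bigr),$$ where $\Gamma_a^{(\ell)}$ is the derivative of $\gamma$ at $a^{(\ell)}$, $(\Psi_a^{(\ell)},\Psi_\theta^{(\ell)})=(\partial_1\psi,\partial_3\psi)(a^{(\ell)},y,\theta)$, $(\mathcal G_u^{(\ell)},\mathcal G_\theta^{(\ell)})=(\partial_1\operatorname{Prox}_{\tau G^*},\partial_3\operatorname{Prox}_{\tau G^*})(U^{(\ell)},y,\theta)$ and $(\mathcal H_x^{(\ell)},\mathcal H_\theta^{(\ell)})=(\partial_1\operatorname{Prox}_{\xi H},\partial_3\operatorname{Prox}_{\xi H})(X^{(\ell)},y,\theta)$. -/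

import Mathlib

open MeasureTheory Set Filter
open scoped NNReal Topology

namespace PrimalDual

noncomputable section

/-! ### Convex analysis -/

section Convex

variable {E : Type*} [NormedAddCommGroup E] [InnerProductSpace ℝ E]

/-- A proper closed (lower semicontinuous) convex function with values in `ℝ ∪ {+∞}`; convexity is
convexity of the epigraph. -/
structure IsProperClosedConvex (f : E → EReal) : Prop where
  ne_bot : ∀ x, f x ≠ ⊥
  exists_ne_top : ∃ x, f x ≠ ⊤
  closed : LowerSemicontinuous f
  convex : Convex ℝ {p : E × ℝ | f p.1 ≤ (p.2 : EReal)}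

/-- `p` minimizes `z ↦ ½ ‖z - x‖² + f z`. -/
def IsProxPoint (f : E → EReal) (x p : E) : Prop :=
  ∀ z : E, ((1 / 2 * ‖p - x‖ ^ 2 : ℝ) : EReal) + f p ≤ ((1 / 2 * ‖z - x‖ ^ 2 : ℝ) : EReal) + f z

/-- The proximity operator: `prox f x` is the minimizer of `z ↦ ½ ‖z - x‖² + f z`, which exists and
is unique when `f` is proper closed convex. -/
def prox (f : E → EReal) (x : E) : E :=
  Classical.epsilon (IsProxPoint f x)

/-- The Legendre–Fenchel conjugate `f*(u) = sup_z ⟨z, u⟩ - f z`. -/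
def conjugate (f : E → EReal) (u : E) : EReal :=
  ⨆ z : E, ((inner ℝ z u : ℝ) : EReal) - f z

end Convex

/-! ### Weak Jacobians and generalized Jacobians -/

section Weak

variable {E F : Type*} [NormedAddCommGroup E] [NormedSpace ℝ E]
  [NormedAddCommGroup F] [NormedSpace ℝ F]

/-- `J` is (a version of) the weak Jacobian of `f` on the open set `Ω`: both are locally integrable
on `Ω` and the integration by parts formula holds, in every direction `v`, against all `C¹` test
functions with compact support in `Ω`. -/
structure IsWeakJacobian [MeasureSpace E] (f : E → F) (Ω : Set E) (J : E → E →L[ℝ] F) : Prop where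
  locallyIntegrableOn : LocallyIntegrableOn f Ω volume
  locallyIntegrableOn_jacobian : LocallyIntegrableOn J Ω volume
  integral_eq : ∀ φ : E → ℝ, ContDiff ℝ 1 φ → HasCompactSupport φ → tsupport φ ⊆ Ω →
    ∀ v : E, ∫ a in Ω, φ a • J a v = - ∫ a in Ω, (fderiv ℝ φ a v) • f a

/-- `f` is weakly differentiable on the open set `Ω`. -/
def IsWeaklyDifferentiableOn [MeasureSpace E] (f : E → F) (Ω : Set E) : Prop :=
  ∃ J : E → E →L[ℝ] F, IsWeakJacobian f Ω J

/-- Clarke's generalized Jacobian of `f` at `p`: the convex hull of all limits of (Fréchet)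
derivatives of `f` at points of differentiability tending to `p`. -/
def clarkeJacobian (f : E → F) (p : E) : Set (E →L[ℝ] F) :=
  convexHull ℝ {A | ∃ q : ℕ → E, (∀ n, DifferentiableAt ℝ f (q n)) ∧ Tendsto q atTop (𝓝 p) ∧
    Tendsto (fun n => fderiv ℝ f (q n)) atTop (𝓝 A)}

/-- A version of the weak Jacobian of `f` on the open set `Ω` which is meaningful at every point of
`Ω`: it is the classical derivative wherever `f` is differentiable, and its values always lie in
Clarke's generalized Jacobian. -/
structure IsJacobianVersion [MeasureSpace E] (f : E → F) (Ω : Set E) (J : E → E →L[ℝ] F) :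
    Prop where
  isWeakJacobian : IsWeakJacobian f Ω J
  eq_fderiv : ∀ p ∈ Ω, DifferentiableAt ℝ f p → J p = fderiv ℝ f p
  mem_clarkeJacobian : ∀ p ∈ Ω, J p ∈ clarkeJacobian f p

end Weak

section Blocks

variable {E T F : Type*} [NormedAddCommGroup E] [NormedSpace ℝ E]
  [NormedAddCommGroup T] [NormedSpace ℝ T] [NormedAddCommGroup F] [NormedSpace ℝ F]

/-- The block of a Jacobian on `E × T` acting on the variable in `E`. -/
def varBlock (A : E × T →L[ℝ] F) : E →L[ℝ] F :=
  A.comp (ContinuousLinearMap.inl ℝ E T)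

/-- The block of a Jacobian on `E × T` acting on the parameter in `T`. -/
def paramBlock (A : E × T →L[ℝ] F) : T →L[ℝ] F :=
  A.comp (ContinuousLinearMap.inr ℝ E T)

end Blocks

/-! ### The primal–dual algorithm -/

section Algorithm

variable {X U Y T : Type*}
  [NormedAddCommGroup X] [InnerProductSpace ℝ X] [CompleteSpace X]
  [NormedAddCommGroup U] [InnerProductSpace ℝ U] [CompleteSpace U]

/-- `Prox_{ξ H}(x, y, θ)`. -/
def proxPrimal (ξ : ℝ) (H : X → Y → T → EReal) (x : X) (y : Y) (θ : T) : X :=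
  prox (fun z => (ξ : EReal) * H z y θ) x

/-- `Prox_{τ G*}(u, y, θ)`, the conjugate being taken in the first variable. -/
def proxDual (τ : ℝ) (G : U → Y → T → EReal) (u : U) (y : Y) (θ : T) : U :=
  prox (fun v => (τ : EReal) * conjugate (fun z => G z y θ) v) u

/-- The dual point `u + τ K x̃`, for `a = (x, x̃, u)`. -/
def dualPoint (τ : ℝ) (K : X →L[ℝ] U) (a : X × X × U) : U :=
  a.2.2 + τ • K a.2.1

/-- The primal point `x - ξ K* u⁺`, for `a = (x, x̃, u)` and the updated dual variable `u⁺`. -/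
def primalPoint (ξ : ℝ) (K : X →L[ℝ] U) (a : X × X × U) (u' : U) : X :=
  a.1 - ξ • ContinuousLinearMap.adjoint K u'

/-- One step `a ↦ ψ(a, y, θ)` of the primal–dual algorithm on `a = (x, x̃, u)`. -/
def step (τ ξ ζ : ℝ) (K : X →L[ℝ] U) (H : X → Y → T → EReal) (G : U → Y → T → EReal)
    (a : X × X × U) (y : Y) (θ : T) : X × X × U :=
  let u' := proxDual τ G (dualPoint τ K a) y θ
  let x' := proxPrimal ξ H (primalPoint ξ K a u') y θ
  (x', x' + ζ • (x' - a.1), u')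

/-- The iterates `a^(ℓ)(y, θ) = (x^(ℓ), x̃^(ℓ), u^(ℓ))(y, θ)` from the initial point `a₀(y, θ)`. -/
def iter (τ ξ ζ : ℝ) (K : X →L[ℝ] U) (H : X → Y → T → EReal) (G : U → Y → T → EReal)
    (a₀ : Y → T → X × X × U) : ℕ → Y → T → X × X × U
  | 0 => a₀
  | ℓ + 1 => fun y θ => step τ ξ ζ K H G (iter τ ξ ζ K H G a₀ ℓ y θ) y θ

/-- The output map `γ`, which reads the primal iterate `x` off `a = (x, x̃, u)`. -/
def output (a : X × X × U) : X := a.1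

end Algorithm

end

end PrimalDual

/-!
Proximity operators are `1`-Lipschitz, so the iteration map is jointly Lipschitz in `(a, θ)` and all
iterates are Lipschitz in `θ`; by Rademacher's theorem they are weakly differentiable, and weak
Jacobians agree almost everywhere with classical derivatives.

The recursions are then chain rules for a Lipschitz map `f` along the graphs `θ ↦ (c θ, θ)` of
countably many Lipschitz curves `c`. A graph may run entirely inside the null set where `f` is not
differentiable, so the values of the Jacobian of `f` on that set matter. Where both `γ` and
`f ∘ γ` are differentiable, Clarke's generalized Jacobian of `f` contains an element `A` with
`A ∘ Dγ = D(f ∘ γ)`: average `Df` against a smooth bump around `γ θ`, which by integration by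
parts reproduces increments of `f`, and let the bump shrink. Choosing such an `A` at every point
of the graphs defines the Jacobian version. One choice serves all the graphs at once because two
graphs can only meet over the same parameter `θ`, and for almost every such `θ` both the curves
and their images under `f` have equal derivatives.
-/

namespace PrimalDual

section Prox

variable {E : Type*} [NormedAddCommGroup E] [InnerProductSpace ℝ E] {f : E → EReal}

theorem IsProperClosedConvex.le_lineMap (hf : IsProperClosedConvex f) {x y : E} {α β t : ℝ}
    (hx : f x ≤ α) (hy : f y ≤ β) (ht : t ∈ Icc (0 : ℝ) 1) :
    f (AffineMap.lineMap x y t) ≤ (AffineMap.lineMap α β t : ℝ) := by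
  have h := hf.convex.lineMap_mem (x := (x, α)) hx (y := (y, β)) hy ht
  simpa [AffineMap.lineMap_apply] using h

theorem IsProperClosedConvex.exists_eq_coe (hf : IsProperClosedConvex f) :
    ∃ (x : E) (α : ℝ), f x = α := by
  obtain ⟨x, hx⟩ := hf.exists_ne_top
  exact ⟨x, (f x).toReal, (EReal.coe_toReal hx (hf.ne_bot x)).symm⟩

theorem IsProperClosedConvex.isClosed_epigraph (hf : IsProperClosedConvex f) :
    IsClosed {p : E × ℝ | f p.1 ≤ (p.2 : EReal)} :=
  hf.closed.isClosed_epigraph.preimage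
    (continuous_fst.prodMk (continuous_coe_real_ereal.comp continuous_snd))

theorem IsProperClosedConvex.exists_affine_le [CompleteSpace E] (hf : IsProperClosedConvex f) :
    ∃ (v : E) (b : ℝ), ∀ z, ((inner ℝ v z + b : ℝ) : EReal) ≤ f z := by
  obtain ⟨w, α, hw⟩ := hf.exists_eq_coe
  have hnotMem : (w, α - 1) ∉ {p : E × ℝ | f p.1 ≤ (p.2 : EReal)} := by
    rw [mem_ofPred_eq, hw, EReal.coe_le_coe_iff, not_le]
    exact sub_one_lt α
  obtain ⟨l, c, hlc, hl⟩ :=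
    geometric_hahn_banach_point_closed hf.convex hf.isClosed_epigraph hnotMem
  have hsplit (z : E) (r : ℝ) : l (z, r) = l (z, 0) + r * l (0, 1) := by
    rw [← smul_eq_mul, ← map_smul, ← map_add]
    simp
  -- The separating functional is not vertical: it is larger at `(w, α)` than at `(w, α - 1)`.
  have hpos : 0 < l (0, 1) := by
    have := hlc.trans (hl (w, α) hw.le)
    rw [hsplit w α, hsplit w (α - 1)] at this
    linarith
  let v : E := (InnerProductSpace.toDual ℝ E).symm (l.comp (ContinuousLinearMap.inl ℝ E ℝ))
  have hv (z : E) : inner ℝ v z = l (z, 0) := by simp [v]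
  refine ⟨-(l (0, 1))⁻¹ • v, c / l (0, 1), fun z => ?_⟩
  refine EReal.le_of_forall_lt_iff_le.1 fun β hβ => ?_
  have h := hl (z, β) hβ.le
  rw [hsplit] at h
  rw [EReal.coe_le_coe_iff, real_inner_smul_left, hv, neg_mul, ← sub_eq_neg_add,
    ← div_eq_inv_mul, ← sub_div, div_le_iff₀ hpos]
  linarith

theorem IsProxPoint.exists_eq_coe (hf : IsProperClosedConvex f) {x p : E}
    (hp : IsProxPoint f x p) : ∃ α : ℝ, f p = α := by
  obtain ⟨z, β, hz⟩ := hf.exists_eq_coe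
  refine ⟨(f p).toReal, (EReal.coe_toReal (fun htop => ?_) (hf.ne_bot p)).symm⟩
  have h := hp z
  rw [htop, hz, EReal.coe_add_top, ← EReal.coe_add] at h
  exact EReal.coe_ne_top _ (top_le_iff.1 h)

theorem IsProxPoint.sub_le_inner (hf : IsProperClosedConvex f) {x p z : E} {α β : ℝ}
    (hp : IsProxPoint f x p) (hα : f p = α) (hβ : f z ≤ β) :
    α - β ≤ inner ℝ (z - p) (p - x) := by
  have key (t : ℝ) (ht : t ∈ Ioc (0 : ℝ) 1) :
      α - β ≤ inner ℝ (z - p) (p - x) + t * (1 / 2 * ‖z - p‖ ^ 2) := by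
    have hmin := (hp (AffineMap.lineMap p z t)).trans
      (add_le_add le_rfl (hf.le_lineMap hα.le hβ (Ioc_subset_Icc_self ht)))
    have hsub : AffineMap.lineMap p z t - x = (p - x) + t • (z - p) := by
      rw [AffineMap.lineMap_apply_module']; abel
    rw [hα, ← EReal.coe_add, ← EReal.coe_add, EReal.coe_le_coe_iff, hsub, norm_add_sq_real,
      norm_smul, inner_smul_right, real_inner_comm, Real.norm_eq_abs, mul_pow, sq_abs,
      AffineMap.lineMap_apply_module', smul_eq_mul] at hmin
    refine le_of_mul_le_mul_left ?_ ht.1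
    linarith
  have hlim : Tendsto (fun t : ℝ => inner ℝ (z - p) (p - x) + t * (1 / 2 * ‖z - p‖ ^ 2))
      (𝓝[>] 0) (𝓝 (inner ℝ (z - p) (p - x))) := by
    refine tendsto_nhdsWithin_of_tendsto_nhds (Continuous.tendsto' (by fun_prop) _ _ (by simp))
  refine ge_of_tendsto hlim ?_
  filter_upwards [Ioc_mem_nhdsGT (zero_lt_one' ℝ)] with t ht using key t ht

theorem IsProxPoint.norm_sub_le (hf : IsProperClosedConvex f) {x x' p p' : E}
    (hp : IsProxPoint f x p) (hp' : IsProxPoint f x' p') : ‖p - p'‖ ≤ ‖x - x'‖ := by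
  obtain ⟨α, hα⟩ := hp.exists_eq_coe hf
  obtain ⟨β, hβ⟩ := hp'.exists_eq_coe hf
  have h : α - β ≤ inner ℝ (p' - p) (p - x) := hp.sub_le_inner hf hα hβ.le
  have h' : β - α ≤ inner ℝ (p - p') (p' - x') := hp'.sub_le_inner hf hβ hα.le
  have hexpand : inner ℝ (p' - p) (p - x) + inner ℝ (p - p') (p' - x') =
      inner ℝ (p - p') (x - x') - ‖p - p'‖ * ‖p - p'‖ := by
    rw [← neg_sub p p', inner_neg_left, neg_add_eq_sub, ← inner_sub_right,
      ← real_inner_self_eq_norm_mul_norm, ← inner_sub_right]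
    congr 1
    abel
  have hcs : inner ℝ (p - p') (x - x') ≤ ‖p - p'‖ * ‖x - x'‖ := real_inner_le_norm _ _
  rcases (norm_nonneg (p - p')).eq_or_lt with h0 | h0
  · exact h0 ▸ norm_nonneg _
  · exact le_of_mul_le_mul_left (by linarith) h0

theorem lowerSemicontinuous_coe_add {α : Type*} [TopologicalSpace α] {f : α → EReal} {g : α → ℝ}
    (hg : Continuous g) (hf : LowerSemicontinuous f) :
    LowerSemicontinuous fun x => ((g x : ℝ) : EReal) + f x :=
  (continuous_coe_real_ereal.comp hg).lowerSemicontinuous.add' hf fun _ =>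
    EReal.continuousAt_add (Or.inl (EReal.coe_ne_top _)) (Or.inl (EReal.coe_ne_bot _))

theorem half_norm_sub_sq_add_inner (x v z : E) :
    1 / 2 * ‖z - x‖ ^ 2 + inner ℝ v z =
      1 / 2 * ‖z - (x - v)‖ ^ 2 + (inner ℝ v x - 1 / 2 * ‖v‖ ^ 2) := by
  have h : z - (x - v) = (z - x) + v := by abel
  rw [h, norm_add_sq_real, inner_sub_left, real_inner_comm, real_inner_comm v x]
  ring

theorem IsProperClosedConvex.exists_isProxPoint [FiniteDimensional ℝ E]
    (hf : IsProperClosedConvex f) (x : E) : ∃ p, IsProxPoint f x p := by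
  obtain ⟨v, b, hvb⟩ := hf.exists_affine_le
  obtain ⟨w, α, hw⟩ := hf.exists_eq_coe
  set m : ℝ := inner ℝ v x - 1 / 2 * ‖v‖ ^ 2 + b
  set M : ℝ := 1 / 2 * ‖w - x‖ ^ 2 + α with hM
  have hlower (z : E) : ((1 / 2 * ‖z - (x - v)‖ ^ 2 + m : ℝ) : EReal) ≤
      ((1 / 2 * ‖z - x‖ ^ 2 : ℝ) : EReal) + f z := by
    have h := add_le_add (le_refl ((1 / 2 * ‖z - x‖ ^ 2 : ℝ) : EReal)) (hvb z)
    rwa [← EReal.coe_add, ← add_assoc, half_norm_sub_sq_add_inner, add_assoc] at h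
  -- By `hlower`, the objective exceeds its value `M` at `w` outside this ball.
  set R : ℝ := √(2 * (M - m))
  have hwR : w ∈ Metric.closedBall (x - v) R := by
    have h := hlower w
    rw [hw, ← EReal.coe_add, EReal.coe_le_coe_iff] at h
    rw [mem_closedBall_iff_norm]
    exact Real.le_sqrt_of_sq_le (by linarith)
  have hlsc : LowerSemicontinuous fun z => ((1 / 2 * ‖z - x‖ ^ 2 : ℝ) : EReal) + f z :=
    lowerSemicontinuous_coe_add (by fun_prop) hf.closed
  obtain ⟨p, -, hp⟩ := LowerSemicontinuousOn.exists_isMinOn ⟨w, hwR⟩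
    (isCompact_closedBall (x - v) R) (hlsc.lowerSemicontinuousOn _)
  refine ⟨p, fun z => ?_⟩
  by_cases hz : z ∈ Metric.closedBall (x - v) R
  · exact hp hz
  refine (hp hwR).trans (le_trans ?_ (hlower z))
  have hsq : 2 * (M - m) < ‖z - (x - v)‖ ^ 2 :=
    Real.lt_sq_of_sqrt_lt (by rwa [mem_closedBall_iff_norm, not_le] at hz)
  dsimp only
  rw [hw, ← EReal.coe_add, EReal.coe_le_coe_iff, ← hM]
  linarith

theorem IsProperClosedConvex.isProxPoint_prox [FiniteDimensional ℝ E]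
    (hf : IsProperClosedConvex f) (x : E) : IsProxPoint f x (prox f x) :=
  Classical.epsilon_spec (hf.exists_isProxPoint x)

theorem IsProperClosedConvex.lipschitzWith_prox [FiniteDimensional ℝ E]
    (hf : IsProperClosedConvex f) : LipschitzWith 1 (prox f) :=
  LipschitzWith.of_dist_le_mul fun x x' => by
    simpa [dist_eq_norm] using (hf.isProxPoint_prox x).norm_sub_le hf (hf.isProxPoint_prox x')

theorem coe_mul_le_coe_iff {c r : ℝ} (hc : 0 < c) (a : EReal) :
    (c : EReal) * a ≤ r ↔ a ≤ ((c⁻¹ * r : ℝ) : EReal) := by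
  rw [← div_eq_inv_mul, EReal.coe_div, EReal.le_div_iff_mul_le (by exact_mod_cast hc)
    (EReal.coe_ne_top c), mul_comm]

theorem IsProperClosedConvex.const_mul (hf : IsProperClosedConvex f) {c : ℝ} (hc : 0 < c) :
    IsProperClosedConvex fun x => (c : EReal) * f x where
  ne_bot x := by
    induction hx : f x with
    | bot => exact absurd hx (hf.ne_bot x)
    | coe α => exact EReal.coe_ne_bot _
    | top => simp [EReal.coe_mul_top_of_pos hc]
  exists_ne_top := by
    obtain ⟨x, α, hx⟩ := hf.exists_eq_coe
    exact ⟨x, by rw [hx, ← EReal.coe_mul]; exact EReal.coe_ne_top _⟩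
  closed := by
    have hc' : (0 : EReal) < c := by exact_mod_cast hc
    refine lowerSemicontinuous_iff_isOpen_preimage.2 fun r => ?_
    have hpre : (fun x => (c : EReal) * f x) ⁻¹' Ioi r = f ⁻¹' Ioi (r / c) := by
      ext x
      simp only [mem_preimage, mem_Ioi, EReal.div_lt_iff hc' (EReal.coe_ne_top c), mul_comm]
    exact hpre ▸ hf.closed.isOpen_preimage _
  convex := by
    let l := (LinearMap.id : E →ₗ[ℝ] E).prodMap (c⁻¹ • (LinearMap.id : ℝ →ₗ[ℝ] ℝ))
    have hepi : {p : E × ℝ | (c : EReal) * f p.1 ≤ (p.2 : EReal)} =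
        l ⁻¹' {p : E × ℝ | f p.1 ≤ (p.2 : EReal)} := by
      ext p
      simp [l, coe_mul_le_coe_iff hc]
    exact hepi ▸ hf.convex.linear_preimage l

theorem IsProperClosedConvex.conjugate [CompleteSpace E] (hf : IsProperClosedConvex f) :
    IsProperClosedConvex (conjugate f) where
  ne_bot u hu := by
    obtain ⟨x, α, hx⟩ := hf.exists_eq_coe
    have h : ((inner ℝ x u : ℝ) : EReal) - f x ≤ PrimalDual.conjugate f u :=
      le_iSup (fun z : E => ((inner ℝ z u : ℝ) : EReal) - f z) x
    rw [hu, hx, ← EReal.coe_sub] at h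
    exact EReal.coe_ne_bot _ (le_bot_iff.1 h)
  exists_ne_top := by
    obtain ⟨v, b, hvb⟩ := hf.exists_affine_le
    refine ⟨v, ne_top_of_le_ne_top (EReal.coe_ne_top (-b)) (iSup_le fun z => ?_)⟩
    rw [real_inner_comm]
    refine (EReal.sub_le_sub le_rfl (hvb z)).trans ?_
    rw [← EReal.coe_sub]
    simp
  closed := by
    refine lowerSemicontinuous_iSup fun z => Continuous.lowerSemicontinuous ?_
    induction hz : f z with
    | bot => exact absurd hz (hf.ne_bot z)
    | top => simpa using continuous_const
    | coe β =>
      simp only [← EReal.coe_sub]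
      exact continuous_coe_real_ereal.comp (by fun_prop)
  convex := by
    have hepi : {p : E × ℝ | PrimalDual.conjugate f p.1 ≤ (p.2 : EReal)} =
        ⋂ z : E, {p : E × ℝ | ((inner ℝ z p.1 : ℝ) : EReal) - f z ≤ (p.2 : EReal)} := by
      ext p
      simp [PrimalDual.conjugate]
    rw [hepi]
    refine convex_iInter fun z => ?_
    induction hz : f z with
    | bot => exact absurd hz (hf.ne_bot z)
    | top => simpa using convex_univ
    | coe β =>
      simp_rw [← EReal.coe_sub, EReal.coe_le_coe_iff, sub_le_comm (b := β)]
      exact convex_halfSpace_le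
        ((innerSL ℝ z).toLinearMap.comp (.fst ℝ E ℝ) - .snd ℝ E ℝ).isLinear β

end Prox

section Lipschitz

variable {E F : Type*} [NormedAddCommGroup E] [NormedSpace ℝ E] [FiniteDimensional ℝ E]
  [MeasurableSpace E] [BorelSpace E] (μ : Measure E) [μ.IsAddHaarMeasure]
  [NormedAddCommGroup F] [NormedSpace ℝ F] [FiniteDimensional ℝ F]

theorem ae_differentiableAt_of_lipschitzOnWith {f : E → F} {Ω : Set E} {L : ℝ≥0}
    (hΩ : IsOpen Ω) (hf : LipschitzOnWith L f Ω) :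
    ∀ᵐ a ∂(μ.restrict Ω), DifferentiableAt ℝ f a := by
  filter_upwards [hf.ae_differentiableWithinAt (μ := μ) hΩ.measurableSet,
    ae_restrict_mem hΩ.measurableSet] with a ha haΩ
  exact ha.differentiableAt (hΩ.mem_nhds haΩ)

theorem integral_smul_fderiv_eq_neg_real {g : E → ℝ} {L : ℝ≥0} (hg : LipschitzWith L g)
    {φ : E → ℝ} (hφ : ContDiff ℝ 1 φ) (hφc : HasCompactSupport φ) (v : E) :
    ∫ a, φ a • fderiv ℝ g a v ∂μ = - ∫ a, fderiv ℝ φ a v • g a ∂μ := by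
  obtain ⟨C, hC⟩ := hφ.lipschitzWith_of_hasCompactSupport hφc one_ne_zero
  calc ∫ a, φ a • fderiv ℝ g a v ∂μ
      = ∫ a, lineDeriv ℝ g a v * φ a ∂μ := by
        refine integral_congr_ae ?_
        filter_upwards [hg.ae_differentiableAt (μ := μ)] with a ha
        rw [ha.lineDeriv_eq_fderiv, smul_eq_mul, mul_comm]
    _ = ∫ a, lineDeriv ℝ φ a (-v) * g a ∂μ := hg.integral_lineDeriv_mul_eq hC hφc v
    _ = - ∫ a, fderiv ℝ φ a v • g a ∂μ := by
        rw [← integral_neg]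
        refine integral_congr_ae (Eventually.of_forall fun a => ?_)
        simp [(hφ.differentiable one_ne_zero a).lineDeriv_eq_fderiv]

theorem integrable_smul_fderiv_of_lipschitzWith {g : E → F} {L : ℝ≥0} (hg : LipschitzWith L g)
    {φ : E → ℝ} (hφ : Continuous φ) (hφc : HasCompactSupport φ) :
    Integrable (fun a => φ a • fderiv ℝ g a) μ :=
  Integrable.smul_of_top_left (hφ.integrable_of_hasCompactSupport hφc)
    (memLp_top_of_bound (measurable_fderiv ℝ g).aestronglyMeasurable L
      (Eventually.of_forall fun _ => norm_fderiv_le_of_lipschitz ℝ hg))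

theorem integral_smul_fderiv_eq_neg_of_lipschitzWith {g : E → F} {L : ℝ≥0}
    (hg : LipschitzWith L g) {φ : E → ℝ} (hφ : ContDiff ℝ 1 φ) (hφc : HasCompactSupport φ)
    (v : E) :
    ∫ a, φ a • fderiv ℝ g a v ∂μ = - ∫ a, fderiv ℝ φ a v • g a ∂μ := by
  have hleft : Integrable (fun a => φ a • fderiv ℝ g a v) μ :=
    (integrable_smul_fderiv_of_lipschitzWith μ hg hφ.continuous hφc).apply_continuousLinearMap v
  have hright : Integrable (fun a => fderiv ℝ φ a v • g a) μ :=
    (((hφ.continuous_fderiv one_ne_zero).clm_apply continuous_const).smul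
      hg.continuous).integrable_of_hasCompactSupport (hφc.fderiv_apply (𝕜 := ℝ) v).smul_right
  refine (SeparatingDual.eq_iff_forall_dual_eq (R := ℝ)).2 fun l => ?_
  have hl : LipschitzWith (‖l‖₊ * L) (l ∘ g) := l.lipschitz.comp hg
  rw [map_neg, ← l.integral_comp_comm hleft, ← l.integral_comp_comm hright]
  simp only [map_smul]
  refine Eq.trans ?_ (integral_smul_fderiv_eq_neg_real μ hl hφ hφc v)
  refine integral_congr_ae ?_
  filter_upwards [hg.ae_differentiableAt (μ := μ)] with a ha
  rw [fderiv_comp a l.differentiableAt ha, l.fderiv, ContinuousLinearMap.comp_apply]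

theorem ae_fderiv_eq_zero_of_eq_zero_real (f : E → ℝ) :
    ∀ᵐ x ∂μ, f x = 0 → fderiv ℝ f x = 0 := by
  rcases subsingleton_or_nontrivial E with hE | hE
  · exact Eventually.of_forall fun x _ => ContinuousLinearMap.ext fun v => by
      rw [Subsingleton.elim v 0, map_zero, map_zero]
  obtain ⟨v, hv⟩ := exists_ne (0 : E)
  set D : Set E := {x | DifferentiableAt ℝ f x}
  have hcont : ContinuousOn f D := fun x hx => hx.continuousAt.continuousWithinAt
  have hmeas : MeasurableSet (D ∩ f ⁻¹' {0}) := by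
    obtain ⟨C, hC, hCD⟩ := continuousOn_iff_isClosed.1 hcont {0} isClosed_singleton
    rw [inter_comm, hCD]
    exact hC.measurableSet.inter (measurableSet_of_differentiableAt ℝ f)
  -- `ApproximatesLinearOn.norm_fderiv_sub_le` is about self-maps of `E`: pass from `f` to `f • v`.
  have happrox : ApproximatesLinearOn (fun x => f x • v) (0 : E →L[ℝ] E) (D ∩ f ⁻¹' {0}) 0 := by
    rintro x ⟨-, hx⟩ z ⟨-, hz⟩
    simp [show f x = 0 from hx, show f z = 0 from hz]
  have hle := happrox.norm_fderiv_sub_le μ hmeas (fun x => (fderiv ℝ f x).smulRight v)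
    fun x hx => (hx.1.hasFDerivAt.smul_const v).hasFDerivWithinAt
  filter_upwards [(ae_restrict_iff' hmeas).1 hle] with x hx hfx
  by_cases hxD : DifferentiableAt ℝ f x
  · simpa [hv] using hx ⟨hxD, hfx⟩
  · exact fderiv_zero_of_not_differentiableAt hxD

theorem ae_fderiv_eq_of_eq (f g : E → F) :
    ∀ᵐ x ∂μ, f x = g x → DifferentiableAt ℝ f x → DifferentiableAt ℝ g x →
      fderiv ℝ f x = fderiv ℝ g x := by
  let b := Module.finBasis ℝ F
  let coord (i : Fin (Module.finrank ℝ F)) : F →L[ℝ] ℝ := (b.coord i).toContinuousLinearMap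
  have hcoord := ae_all_iff.2 fun i =>
    ae_fderiv_eq_zero_of_eq_zero_real μ fun x => coord i (f x - g x)
  filter_upwards [hcoord] with x hx hfg hf hg
  refine ContinuousLinearMap.ext fun w => b.ext_elem fun i => ?_
  have hderiv := ((coord i).hasFDerivAt.comp x (hf.hasFDerivAt.sub hg.hasFDerivAt)).fderiv
  have hzero : (coord i).comp (fderiv ℝ f x - fderiv ℝ g x) = 0 :=
    hderiv.symm.trans (hx i (by simp [hfg]))
  simpa [coord, sub_eq_zero] using congrArg (fun A : E →L[ℝ] ℝ => A w) hzero

end Lipschitz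

section WeakJacobian

variable {E F G : Type*} [NormedAddCommGroup E] [NormedSpace ℝ E]
  [NormedAddCommGroup F] [NormedSpace ℝ F] [NormedAddCommGroup G] [NormedSpace ℝ G]

theorem integrable_smul_of_locallyIntegrableOn {α : Type*} [TopologicalSpace α]
    [MeasurableSpace α] [OpensMeasurableSpace α] [T2Space α] {μ : Measure α} {g : α → F} {Ω : Set α}
    (hg : LocallyIntegrableOn g Ω μ) {φ : α → ℝ} (hφ : Continuous φ)
    (hφc : HasCompactSupport φ) (hφΩ : tsupport φ ⊆ Ω) :
    Integrable (fun a => φ a • g a) (μ.restrict Ω) := by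
  have hK : IntegrableOn g (tsupport φ) (μ.restrict Ω) :=
    (hg.integrableOn_compact_subset hφΩ hφc).mono_measure Measure.restrict_le_self
  refine (integrableOn_iff_integrable_of_support_subset fun a ha => ?_).1
    (hK.continuousOn_smul hφ.continuousOn hφc)
  exact subset_tsupport φ fun h => ha (by simp [h])

variable [MeasureSpace E] {Ω : Set E} {f g : E → F} {J J' : E → E →L[ℝ] F}

theorem IsWeakJacobian.integrable_smul_apply [BorelSpace E] (hJ : IsWeakJacobian f Ω J)
    {φ : E → ℝ} (hφ : Continuous φ) (hφc : HasCompactSupport φ) (hφΩ : tsupport φ ⊆ Ω) (v : E) :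
    Integrable (fun a => φ a • J a v) (volume.restrict Ω) :=
  (integrable_smul_of_locallyIntegrableOn hJ.locallyIntegrableOn_jacobian hφ hφc
    hφΩ).apply_continuousLinearMap v

theorem IsWeakJacobian.integrable_fderiv_smul [BorelSpace E] (hJ : IsWeakJacobian f Ω J)
    {φ : E → ℝ} (hφ : ContDiff ℝ 1 φ) (hφc : HasCompactSupport φ) (hφΩ : tsupport φ ⊆ Ω) (v : E) :
    Integrable (fun a => fderiv ℝ φ a v • f a) (volume.restrict Ω) :=
  integrable_smul_of_locallyIntegrableOn hJ.locallyIntegrableOn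
    ((hφ.continuous_fderiv one_ne_zero).clm_apply continuous_const)
    (hφc.fderiv_apply (𝕜 := ℝ) v) ((tsupport_fderiv_apply_subset ℝ v).trans hφΩ)

theorem IsWeakJacobian.congr_ae (hJ : IsWeakJacobian f Ω J)
    (h : J =ᵐ[volume.restrict Ω] J') : IsWeakJacobian f Ω J' where
  locallyIntegrableOn := hJ.locallyIntegrableOn
  locallyIntegrableOn_jacobian x hx :=
    let ⟨t, ht, hJt⟩ := hJ.locallyIntegrableOn_jacobian x hx
    ⟨t ∩ Ω, inter_mem ht self_mem_nhdsWithin, (hJt.mono_set inter_subset_left).congr_fun_ae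
      (ae_mono (Measure.restrict_mono inter_subset_right le_rfl) h)⟩
  integral_eq φ hφ hφc hφΩ v := by
    rw [← hJ.integral_eq φ hφ hφc hφΩ v]
    exact integral_congr_ae (h.mono fun a ha => by simp only [ha])

theorem IsWeakJacobian.sub [BorelSpace E] (hJ : IsWeakJacobian f Ω J)
    (hJ' : IsWeakJacobian g Ω J') :
    IsWeakJacobian (fun a => f a - g a) Ω fun a => J a - J' a where
  locallyIntegrableOn := hJ.locallyIntegrableOn.sub hJ'.locallyIntegrableOn
  locallyIntegrableOn_jacobian :=
    hJ.locallyIntegrableOn_jacobian.sub hJ'.locallyIntegrableOn_jacobian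
  integral_eq φ hφ hφc hφΩ v := by
    simp only [sub_apply, smul_sub]
    rw [integral_sub (hJ.integrable_smul_apply hφ.continuous hφc hφΩ v)
        (hJ'.integrable_smul_apply hφ.continuous hφc hφΩ v),
      integral_sub (hJ.integrable_fderiv_smul hφ hφc hφΩ v)
        (hJ'.integrable_fderiv_smul hφ hφc hφΩ v),
      hJ.integral_eq φ hφ hφc hφΩ v, hJ'.integral_eq φ hφ hφc hφΩ v, neg_sub_neg, neg_sub]

theorem IsWeakJacobian.clm_comp [BorelSpace E] [CompleteSpace F] [CompleteSpace G]
    (hJ : IsWeakJacobian f Ω J) (l : F →L[ℝ] G) :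
    IsWeakJacobian (fun a => l (f a)) Ω fun a => l.comp (J a) where
  locallyIntegrableOn := l.locallyIntegrableOn_comp hJ.locallyIntegrableOn
  locallyIntegrableOn_jacobian :=
    (ContinuousLinearMap.compL ℝ E F G l).locallyIntegrableOn_comp hJ.locallyIntegrableOn_jacobian
  integral_eq φ hφ hφc hφΩ v := by
    simp only [ContinuousLinearMap.comp_apply, ← l.map_smul]
    rw [l.integral_comp_comm (hJ.integrable_smul_apply hφ.continuous hφc hφΩ v),
      l.integral_comp_comm (hJ.integrable_fderiv_smul hφ hφc hφΩ v),
      hJ.integral_eq φ hφ hφc hφΩ v, map_neg]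

theorem IsWeakJacobian.const_smul [BorelSpace E] [CompleteSpace F] (hJ : IsWeakJacobian f Ω J)
    (c : ℝ) : IsWeakJacobian (fun a => c • f a) Ω fun a => c • J a :=
  hJ.clm_comp (c • ContinuousLinearMap.id ℝ F)

theorem IsWeakJacobian.add [BorelSpace E] [CompleteSpace F] (hJ : IsWeakJacobian f Ω J)
    (hJ' : IsWeakJacobian g Ω J') :
    IsWeakJacobian (fun a => f a + g a) Ω fun a => J a + J' a := by
  simpa only [neg_smul, one_smul, sub_neg_eq_add] using hJ.sub (hJ'.const_smul (-1))

theorem IsWeaklyDifferentiableOn.clm_comp [BorelSpace E] [CompleteSpace F] [CompleteSpace G]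
    (hf : IsWeaklyDifferentiableOn f Ω) (l : F →L[ℝ] G) :
    IsWeaklyDifferentiableOn (fun a => l (f a)) Ω :=
  let ⟨_, hJ⟩ := hf
  ⟨_, hJ.clm_comp l⟩

theorem IsWeaklyDifferentiableOn.fst [BorelSpace E] [CompleteSpace F] [CompleteSpace G]
    {f : E → F × G} (hf : IsWeaklyDifferentiableOn f Ω) :
    IsWeaklyDifferentiableOn (fun a => (f a).1) Ω :=
  hf.clm_comp (.fst ℝ F G)

theorem IsWeaklyDifferentiableOn.snd [BorelSpace E] [CompleteSpace F] [CompleteSpace G]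
    {f : E → F × G} (hf : IsWeaklyDifferentiableOn f Ω) :
    IsWeaklyDifferentiableOn (fun a => (f a).2) Ω :=
  hf.clm_comp (.snd ℝ F G)

variable [BorelSpace E] [FiniteDimensional ℝ E]

theorem IsWeakJacobian.ae_eq [CompleteSpace F] (hΩ : IsOpen Ω) (hJ : IsWeakJacobian f Ω J)
    (hJ' : IsWeakJacobian f Ω J') : ∀ᵐ a ∂(volume.restrict Ω), J a = J' a := by
  have happly (v : E) : ∀ᵐ a ∂(volume : Measure E), a ∈ Ω → J a v - J' a v = 0 := by
    refine hΩ.ae_eq_zero_of_integral_contDiff_smul_eq_zero (f := fun a => J a v - J' a v) ?_ ?_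
    · exact (ContinuousLinearMap.apply ℝ F v).locallyIntegrableOn_comp
        (hJ.locallyIntegrableOn_jacobian.sub hJ'.locallyIntegrableOn_jacobian)
    · intro φ hφ hφc hφΩ
      have hφ1 : ContDiff ℝ 1 φ := hφ.of_le (by exact_mod_cast le_top)
      have hvanish (a : E) (ha : a ∉ Ω) : φ a • (J a v - J' a v) = 0 := by
        rw [image_eq_zero_of_notMem_tsupport fun h => ha (hφΩ h), zero_smul]
      rw [← setIntegral_eq_integral_of_forall_compl_eq_zero hvanish]
      simp only [smul_sub]
      rw [integral_sub (hJ.integrable_smul_apply hφ1.continuous hφc hφΩ v)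
        (hJ'.integrable_smul_apply hφ1.continuous hφc hφΩ v),
        hJ.integral_eq φ hφ1 hφc hφΩ v, hJ'.integral_eq φ hφ1 hφc hφΩ v, sub_self]
  let b := Module.finBasis ℝ E
  rw [ae_restrict_iff' hΩ.measurableSet]
  filter_upwards [ae_all_iff.2 fun i => happly (b i)] with a ha haΩ
  exact ContinuousLinearMap.coe_injective (b.ext fun i => sub_eq_zero.1 (ha i haΩ))

variable [(volume : Measure E).IsAddHaarMeasure] [FiniteDimensional ℝ F] {L : ℝ≥0}

theorem locallyIntegrableOn_fderiv_of_lipschitzOnWith (hΩ : IsOpen Ω)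
    (hf : LipschitzOnWith L f Ω) : LocallyIntegrableOn (fderiv ℝ f) Ω volume := by
  refine (locallyIntegrableOn_iff hΩ.isLocallyClosed).2 fun k hkΩ hk => ?_
  refine IntegrableOn.of_bound hk.measure_lt_top
    (measurable_fderiv ℝ f).aestronglyMeasurable L ?_
  filter_upwards [ae_restrict_mem hk.measurableSet] with a ha
  exact norm_fderiv_le_of_lipschitzOn ℝ (hΩ.mem_nhds (hkΩ ha)) hf

theorem isWeakJacobian_fderiv_of_lipschitzOnWith (hΩ : IsOpen Ω) (hf : LipschitzOnWith L f Ω) :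
    IsWeakJacobian f Ω (fderiv ℝ f) where
  locallyIntegrableOn := hf.continuousOn.locallyIntegrableOn hΩ.measurableSet
  locallyIntegrableOn_jacobian := locallyIntegrableOn_fderiv_of_lipschitzOnWith hΩ hf
  integral_eq φ hφ hφc hφΩ v := by
    obtain ⟨g, hg, hfg⟩ := hf.extend_finite_dimension
    have hleft (a : E) (ha : a ∉ Ω) : φ a • fderiv ℝ g a v = 0 := by
      rw [image_eq_zero_of_notMem_tsupport fun h => ha (hφΩ h), zero_smul]
    have hright (a : E) (ha : a ∉ Ω) : fderiv ℝ φ a v • g a = 0 := by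
      rw [image_eq_zero_of_notMem_tsupport fun h => ha (hφΩ (tsupport_fderiv_subset ℝ h)),
        zero_apply, zero_smul]
    calc ∫ a in Ω, φ a • fderiv ℝ f a v
        = ∫ a in Ω, φ a • fderiv ℝ g a v :=
          setIntegral_congr_fun hΩ.measurableSet fun a ha => by
            simp only [(hfg.eventuallyEq_of_mem (hΩ.mem_nhds ha)).fderiv_eq (𝕜 := ℝ)]
      _ = - ∫ a in Ω, fderiv ℝ φ a v • g a := by
          rw [setIntegral_eq_integral_of_forall_compl_eq_zero hleft,
            setIntegral_eq_integral_of_forall_compl_eq_zero hright]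
          exact integral_smul_fderiv_eq_neg_of_lipschitzWith volume hg hφ hφc v
      _ = - ∫ a in Ω, fderiv ℝ φ a v • f a :=
          congrArg Neg.neg (setIntegral_congr_fun hΩ.measurableSet fun a ha => by
            simp only [hfg ha])

theorem isWeaklyDifferentiableOn_of_lipschitzOnWith (hΩ : IsOpen Ω) (hf : LipschitzOnWith L f Ω) :
    IsWeaklyDifferentiableOn f Ω :=
  ⟨_, isWeakJacobian_fderiv_of_lipschitzOnWith hΩ hf⟩

theorem IsWeakJacobian.ae_eq_fderiv (hΩ : IsOpen Ω) (hf : LipschitzOnWith L f Ω)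
    (hJ : IsWeakJacobian f Ω J) : ∀ᵐ a ∂(volume.restrict Ω), J a = fderiv ℝ f a :=
  hJ.ae_eq hΩ (isWeakJacobian_fderiv_of_lipschitzOnWith hΩ hf)

end WeakJacobian

section ConvexHull

variable {V : Type*} [NormedAddCommGroup V] [NormedSpace ℝ V] [FiniteDimensional ℝ V]

theorem convexHull_eq_image_stdSimplex (s : Set V) :
    convexHull ℝ s =
      (fun q : (Fin (Module.finrank ℝ V + 1) → ℝ) × (Fin (Module.finrank ℝ V + 1) → V) =>
        ∑ i, q.1 i • q.2 i) '' (stdSimplex ℝ _ ×ˢ univ.pi fun _ => s) := by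
  refine Subset.antisymm (fun x hx => ?_) ?_
  · obtain ⟨x₀, hx₀⟩ := convexHull_nonempty_iff.1 ⟨x, hx⟩
    obtain ⟨ι, hι, z, w, hz, hzi, hw, hw1, rfl⟩ := eq_pos_convex_span_of_mem_convexHull hx
    obtain ⟨e⟩ := Function.Embedding.nonempty_of_card_le
      (show Fintype.card ι ≤ Fintype.card (Fin (Module.finrank ℝ V + 1)) by
        rw [Fintype.card_fin]
        exact hzi.card_le_finrank_succ.trans (Nat.succ_le_succ (Submodule.finrank_le _)))
    have hw_of_notMem {i} (hi : i ∉ range e) : Function.extend e w 0 i = 0 :=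
      Function.extend_apply' _ _ _ hi
    refine ⟨(Function.extend e w 0, Function.extend e z fun _ => x₀), ⟨⟨fun i => ?_, ?_⟩,
      fun i _ => ?_⟩, ?_⟩
    · by_cases hi : i ∈ range e
      · obtain ⟨a, rfl⟩ := hi
        simpa only [e.injective.extend_apply] using (hw a).le
      · exact (hw_of_notMem hi).ge
    · rw [← hw1]
      exact (Fintype.sum_of_injective e e.injective _ _ (fun i hi => hw_of_notMem hi)
        fun a => (e.injective.extend_apply _ _ a).symm).symm
    · by_cases hi : i ∈ range e
      · obtain ⟨a, rfl⟩ := hi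
        simpa only [e.injective.extend_apply] using hz (mem_range_self a)
      · simpa only [Function.extend_apply' z _ i hi] using hx₀
    · refine (Fintype.sum_of_injective e e.injective _ _ (fun i hi => ?_) fun a => ?_).symm
      · simp only [hw_of_notMem hi, zero_smul]
      · simp only [e.injective.extend_apply]
  · rintro _ ⟨⟨w, z⟩, ⟨hw, hz⟩, rfl⟩
    exact (convex_convexHull ℝ s).sum_mem (fun i _ => hw.1 i) hw.2
      fun i _ => subset_convexHull ℝ s (hz i (mem_univ i))

theorem isCompact_convexHull_of_isCompact {s : Set V} (hs : IsCompact s) :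
    IsCompact (convexHull ℝ s) := by
  rw [convexHull_eq_image_stdSimplex]
  exact ((isCompact_stdSimplex ℝ _).prod (isCompact_univ_pi fun _ => hs)).image (by fun_prop)

theorem iInter_convexHull_subset_of_antitone {s : ℕ → Set V} (hs : Antitone s)
    (hsc : ∀ n, IsCompact (s n)) : ⋂ n, convexHull ℝ (s n) ⊆ convexHull ℝ (⋂ n, s n) := by
  intro x hx
  let Φ (q : (Fin (Module.finrank ℝ V + 1) → ℝ) × (Fin (Module.finrank ℝ V + 1) → V)) : V :=
    ∑ i, q.1 i • q.2 i
  let K (n : ℕ) := (stdSimplex ℝ _ ×ˢ univ.pi fun _ => s n) ∩ Φ ⁻¹' {x}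
  have hKc (n : ℕ) : IsCompact (K n) :=
    ((isCompact_stdSimplex ℝ _).prod (isCompact_univ_pi fun _ => hsc n)).inter_right
      (isClosed_singleton.preimage (by fun_prop))
  have hK (n : ℕ) : (K n).Nonempty := by
    obtain ⟨q, hq, hqx⟩ := (convexHull_eq_image_stdSimplex (s n)).subset (mem_iInter.1 hx n)
    exact ⟨q, hq, hqx⟩
  obtain ⟨q, hq⟩ := IsCompact.nonempty_iInter_of_sequence_nonempty_isCompact_isClosed K
    (fun n => inter_subset_inter_left _ (prod_mono_right (pi_mono fun _ _ => hs n.le_succ)))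
    hK (hKc 0) fun n => (hKc n).isClosed
  have hqK (n : ℕ) : q ∈ K n := mem_iInter.1 hq n
  rw [convexHull_eq_image_stdSimplex]
  exact ⟨q, ⟨(hqK 0).1.1, fun i hi => mem_iInter.2 fun n => (hqK n).1.2 i hi⟩, (hqK 0).2⟩

end ConvexHull

section Clarke

open Metric

variable {E F : Type*} [NormedAddCommGroup E] [NormedSpace ℝ E]
  [NormedAddCommGroup F] [NormedSpace ℝ F] {f g : E → F} {p : E}

theorem fderiv_mem_clarkeJacobian (hf : DifferentiableAt ℝ f p) :
    fderiv ℝ f p ∈ clarkeJacobian f p :=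
  subset_convexHull ℝ _ ⟨fun _ => p, fun _ => hf, tendsto_const_nhds, tendsto_const_nhds⟩

theorem clarkeJacobian_subset_of_eventuallyEq (h : f =ᶠ[𝓝 p] g) :
    clarkeJacobian f p ⊆ clarkeJacobian g p := by
  refine convexHull_mono ?_
  rintro A ⟨q, hq, hqp, hA⟩
  obtain ⟨N, hN⟩ : ∃ N, ∀ n ≥ N, f =ᶠ[𝓝 (q n)] g :=
    eventually_atTop.1 (hqp.eventually h.eventually_nhds)
  have hfg (n : ℕ) : f =ᶠ[𝓝 (q (n + N))] g := hN _ (Nat.le_add_left N n)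
  exact ⟨fun n => q (n + N), fun n => (hfg n).differentiableAt_iff.1 (hq _),
    hqp.comp (tendsto_add_atTop_nat N),
    (hA.comp (tendsto_add_atTop_nat N)).congr fun n => (hfg n).fderiv_eq⟩

/-- The derivatives of `g` at its points of differentiability in the ball of radius `r` at `p`.
For Lipschitz `g`, Clarke's generalized Jacobian at `p` contains the intersection over `r > 0` of
the convex hulls of the closures of these sets. -/
def derivNear (g : E → F) (p : E) (r : ℝ) : Set (E →L[ℝ] F) :=
  fderiv ℝ g '' {q | q ∈ ball p r ∧ DifferentiableAt ℝ g q}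

theorem derivNear_mono (g : E → F) (p : E) : Monotone (derivNear g p) := fun _ _ h =>
  image_mono fun _ hq => ⟨ball_subset_ball h hq.1, hq.2⟩

theorem exists_tendsto_fderiv_of_mem_iInter_closure_derivNear {A : E →L[ℝ] F}
    (hA : ∀ n : ℕ, A ∈ closure (derivNear g p (1 / ((n : ℝ) + 1)))) :
    ∃ q : ℕ → E, (∀ n, DifferentiableAt ℝ g (q n)) ∧ Tendsto q atTop (𝓝 p) ∧
      Tendsto (fun n => fderiv ℝ g (q n)) atTop (𝓝 A) := by
  have hnear (n : ℕ) : ∃ q, (q ∈ ball p (1 / ((n : ℝ) + 1)) ∧ DifferentiableAt ℝ g q) ∧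
      dist (fderiv ℝ g q) A < 1 / ((n : ℝ) + 1) := by
    obtain ⟨_, ⟨q, hq, rfl⟩, hqA⟩ := mem_closure_iff.1 (hA n) _ Nat.one_div_pos_of_nat
    exact ⟨q, hq, dist_comm A _ ▸ hqA⟩
  choose q hq hqA using hnear
  exact ⟨q, fun n => (hq n).2,
    tendsto_iff_dist_tendsto_zero.2 (squeeze_zero (fun _ => dist_nonneg)
      (fun n => (mem_ball.1 (hq n).1).le) tendsto_one_div_add_atTop_nhds_zero_nat),
    tendsto_iff_dist_tendsto_zero.2 (squeeze_zero (fun _ => dist_nonneg)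
      (fun n => (hqA n).le) tendsto_one_div_add_atTop_nhds_zero_nat)⟩

variable [FiniteDimensional ℝ E] [FiniteDimensional ℝ F] {C : ℝ≥0}

theorem isCompact_closure_derivNear (hg : LipschitzWith C g) (p : E) (r : ℝ) :
    IsCompact (closure (derivNear g p r)) := by
  have : ProperSpace (E →L[ℝ] F) := FiniteDimensional.proper_real _
  refine (isBounded_closedBall (x := 0) (r := C)).subset ?_ |>.isCompact_closure
  rintro _ ⟨q, -, rfl⟩
  exact mem_closedBall_zero_iff.2 (norm_fderiv_le_of_lipschitz ℝ hg)

theorem mem_clarkeJacobian_of_forall_mem_convexHull (hg : LipschitzWith C g) {A : E →L[ℝ] F}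
    (hA : ∀ n : ℕ, A ∈ convexHull ℝ (closure (derivNear g p (1 / ((n : ℝ) + 1))))) :
    A ∈ clarkeJacobian g p := by
  have hanti : Antitone fun n : ℕ => closure (derivNear g p (1 / ((n : ℝ) + 1))) :=
    fun m n hmn => closure_mono (derivNear_mono g p (Nat.one_div_le_one_div hmn))
  refine convexHull_mono (fun B hB => ?_) (iInter_convexHull_subset_of_antitone hanti
    (fun n => isCompact_closure_derivNear hg p _) (mem_iInter.2 hA))
  exact exists_tendsto_fderiv_of_mem_iInter_closure_derivNear (mem_iInter.1 hB)

end Clarke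

section MeanDerivative

open Metric

theorem integral_smul_mem_of_density {α V : Type*} [MeasurableSpace α] [NormedAddCommGroup V]
    [NormedSpace ℝ V] [CompleteSpace V] {μ : Measure α} {η : α → ℝ} (hη : Measurable η)
    (hη0 : 0 ≤ η) (hη1 : ∫ w, η w ∂μ = 1) {S : Set V} (hS : Convex ℝ S) (hSc : IsClosed S)
    {u : α → V} (hu : ∀ᵐ w ∂μ, η w ≠ 0 → u w ∈ S) (hui : Integrable (fun w => η w • u w) μ) :
    ∫ w, η w • u w ∂μ ∈ S := by
  lift η to α → ℝ≥0 using hη0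
  have hη' : Measurable η := measurable_coe_nnreal_real_iff.1 hη
  have hprob : IsProbabilityMeasure (μ.withDensity fun w => (η w : ENNReal)) := ⟨by
    rw [withDensity_apply _ MeasurableSet.univ, Measure.restrict_univ,
      lintegral_coe_eq_integral _ (integrable_of_integral_eq_one hη1), hη1, ENNReal.ofReal_one]⟩
  simp only [← NNReal.smul_def] at hui ⊢
  rw [← integral_withDensity_eq_integral_smul hη']
  refine hS.integral_mem hSc ?_ ((integrable_withDensity_iff_integrable_smul hη').2 hui)
  rw [ae_withDensity_iff hη'.coe_nnreal_ennreal]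
  simpa only [ne_eq, ENNReal.coe_eq_zero, NNReal.coe_eq_zero] using hu

variable {T E F : Type*} [NormedAddCommGroup T] [NormedSpace ℝ T]
  [NormedAddCommGroup E] [NormedSpace ℝ E] [NormedAddCommGroup F] [NormedSpace ℝ F]
  [FiniteDimensional ℝ F] {g : E → F} {C : ℝ≥0}

section Sampling

variable [FiniteDimensional ℝ E] [MeasurableSpace E] [BorelSpace E] {α : Type*}
  [MeasurableSpace α] {ν : Measure α}

theorem integrable_smul_fderiv_comp (hg : LipschitzWith C g) {η : α → ℝ} (hη : Integrable η ν)
    {q : α → E} (hq : Measurable q) :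
    Integrable (fun w => η w • fderiv ℝ g (q w)) ν :=
  hη.smul_of_top_left (memLp_top_of_bound ((measurable_fderiv ℝ g).comp hq).aestronglyMeasurable C
    (Eventually.of_forall fun _ => norm_fderiv_le_of_lipschitz ℝ hg))

theorem exists_ae_differentiableAt_add (hg : LipschitzWith C g) [SFinite ν] {q : α → E}
    (hq : Measurable q) {ρ : ℝ} (hρ : 0 < ρ) :
    ∃ z : E, ‖z‖ < ρ ∧ ∀ᵐ w ∂ν, DifferentiableAt ℝ g (q w + z) := by
  let lam : Measure E := Measure.addHaar
  have hmeas : MeasurableSet {x : α × E | DifferentiableAt ℝ g (q x.1 + x.2)} :=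
    (measurableSet_of_differentiableAt ℝ g).preimage (by fun_prop)
  have hae : ∀ᵐ w ∂ν, ∀ᵐ z ∂lam, DifferentiableAt ℝ g (q w + z) :=
    Eventually.of_forall fun w =>
      (measurePreserving_add_left lam (q w)).quasiMeasurePreserving.ae hg.ae_differentiableAt
  have := (Measure.ae_ae_comm hmeas).1 hae
  have hpos : lam (ball 0 ρ) ≠ 0 := (measure_ball_pos lam 0 hρ).ne'
  obtain ⟨z, hz, hdiff⟩ := (frequently_ae_mem_iff.2 hpos).and_eventually this |>.exists
  exact ⟨z, mem_ball_zero_iff.1 hz, hdiff⟩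

end Sampling

variable [MeasurableSpace T] [BorelSpace T] (μ : Measure T)

theorem integral_smul_fderiv_comp_sub_eq [FiniteDimensional ℝ E] (hg : LipschitzWith C g)
    {η : T → ℝ} (hη : ∫ w, η w ∂μ = 1) {c : E} {D : T →L[ℝ] E} (y : F) (B : T →L[ℝ] F)
    (hdiff : ∀ᵐ w ∂μ, DifferentiableAt ℝ g (c + D w)) :
    (∫ w, η w • fderiv ℝ g (c + D w) ∂μ).comp D - B =
      ∫ w, η w • fderiv ℝ (fun w => g (c + D w) - (y + B w)) w ∂μ := by
  borelize E
  have hηi : Integrable η μ := integrable_of_integral_eq_one hη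
  have hAi := integrable_smul_fderiv_comp hg hηi (q := fun w => c + D w) (by fun_prop)
  let precomp : (E →L[ℝ] F) →L[ℝ] T →L[ℝ] F := (ContinuousLinearMap.compL ℝ T E F).flip D
  calc (∫ w, η w • fderiv ℝ g (c + D w) ∂μ).comp D - B
      = ∫ w, precomp (η w • fderiv ℝ g (c + D w)) ∂μ - ∫ w, η w • B ∂μ := by
        rw [precomp.integral_comp_comm hAi, integral_smul_const, hη, one_smul]
        rfl
    _ = ∫ w, (precomp (η w • fderiv ℝ g (c + D w)) - η w • B) ∂μ :=
        (integral_sub (precomp.integrable_comp hAi) (hηi.smul_const B)).symm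
    _ = ∫ w, η w • fderiv ℝ (fun w => g (c + D w) - (y + B w)) w ∂μ := by
        refine integral_congr_ae ?_
        filter_upwards [hdiff] with w hw
        have hfderiv : HasFDerivAt (fun w => g (c + D w) - (y + B w))
            ((fderiv ℝ g (c + D w)).comp D - B) w :=
          (hw.hasFDerivAt.comp w (D.hasFDerivAt.const_add c)).sub (B.hasFDerivAt.const_add y)
        rw [hfderiv.fderiv, smul_sub, map_smul]
        rfl

variable [FiniteDimensional ℝ T] [μ.IsAddHaarMeasure]

theorem norm_integral_smul_fderiv_le {η : T → ℝ} (hη : ContDiff ℝ 1 η) (hηc : HasCompactSupport η)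
    {k : T → F} {L : ℝ≥0} (hk : LipschitzWith L k) {δ : ℝ} (hδ : 0 ≤ δ)
    (hkδ : ∀ w ∈ tsupport η, ‖k w‖ ≤ δ) :
    ‖∫ w, η w • fderiv ℝ k w ∂μ‖ ≤ δ * ∫ w, ‖fderiv ℝ η w‖ ∂μ := by
  refine ContinuousLinearMap.opNorm_le_bound _ (by positivity) fun v => ?_
  have hηi : Integrable (fun w => ‖fderiv ℝ η w‖) μ :=
    ((hη.continuous_fderiv one_ne_zero).integrable_of_hasCompactSupport (hηc.fderiv (𝕜 := ℝ))).norm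
  rw [ContinuousLinearMap.integral_apply
    (integrable_smul_fderiv_of_lipschitzWith μ hk hη.continuous hηc)]
  simp only [smul_apply]
  calc ‖∫ w, η w • fderiv ℝ k w v ∂μ‖
      = ‖∫ w, fderiv ℝ η w v • k w ∂μ‖ := by
        rw [integral_smul_fderiv_eq_neg_of_lipschitzWith μ hk hη hηc v, norm_neg]
    _ ≤ ∫ w, ‖fderiv ℝ η w‖ * (‖v‖ * δ) ∂μ := by
        refine norm_integral_le_of_norm_le (hηi.mul_const _) (Eventually.of_forall fun w => ?_)
        by_cases hw : w ∈ tsupport (fderiv ℝ η)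
        · rw [norm_smul, ← mul_assoc]
          exact mul_le_mul (ContinuousLinearMap.le_opNorm _ _)
            (hkδ w (tsupport_fderiv_subset ℝ hw)) (norm_nonneg _) (by positivity)
        · simp only [image_eq_zero_of_notMem_tsupport hw, zero_apply,
            zero_smul, norm_zero, zero_mul, le_refl]
    _ = δ * (∫ w, ‖fderiv ℝ η w‖ ∂μ) * ‖v‖ := by rw [integral_mul_const]; ring

theorem exists_mem_convexHull_norm_comp_sub_le_of_close [FiniteDimensional ℝ E]
    (hg : LipschitzWith C g) (b : ContDiffBump (0 : T)) {p c : E} {r δ : ℝ} (hδ : 0 ≤ δ)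
    {y : F} {D : T →L[ℝ] E} {B : T →L[ℝ] F} (hdiff : ∀ᵐ w ∂μ, DifferentiableAt ℝ g (c + D w))
    (hball : ∀ w ∈ closedBall 0 b.rOut, c + D w ∈ ball p r)
    (hclose : ∀ w ∈ closedBall 0 b.rOut, ‖g (c + D w) - (y + B w)‖ ≤ δ) :
    ∃ A ∈ convexHull ℝ (closure (derivNear g p r)),
      ‖A.comp D - B‖ ≤ δ * ∫ w, ‖fderiv ℝ (b.normed μ) w‖ ∂μ := by
  borelize E
  refine ⟨∫ w, b.normed μ w • fderiv ℝ g (c + D w) ∂μ, ?_, ?_⟩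
  · refine integral_smul_mem_of_density b.continuous_normed.measurable b.nonneg_normed
      b.integral_normed (convex_convexHull ℝ _)
      (isCompact_convexHull_of_isCompact (isCompact_closure_derivNear hg p r)).isClosed ?_
      (integrable_smul_fderiv_comp hg (integrable_of_integral_eq_one b.integral_normed)
        (by fun_prop))
    filter_upwards [hdiff] with w hw hηw
    have hwb : w ∈ closedBall 0 b.rOut := b.tsupport_normed_eq (μ := μ) ▸ subset_tsupport _ hηw
    exact subset_convexHull ℝ _ (subset_closure ⟨_, ⟨hball w hwb, hw⟩, rfl⟩)
  · rw [integral_smul_fderiv_comp_sub_eq μ hg b.integral_normed y B hdiff]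
    have hlip : LipschitzWith (C * (0 + ‖D‖₊) + (0 + ‖B‖₊)) fun w => g (c + D w) - (y + B w) :=
      (hg.comp ((LipschitzWith.const c).add D.lipschitz)).sub
        ((LipschitzWith.const y).add B.lipschitz)
    exact norm_integral_smul_fderiv_le μ b.contDiff_normed b.hasCompactSupport_normed hlip hδ
      fun w hw => hclose w (b.tsupport_normed_eq (μ := μ) ▸ hw)

end MeanDerivative

section Tangential

open Metric

variable {T E F : Type*} [NormedAddCommGroup T] [NormedSpace ℝ T]
  [NormedAddCommGroup E] [NormedSpace ℝ E] [NormedAddCommGroup F] [NormedSpace ℝ F]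

theorem hasFDerivAt_comp_tangent {g : E → F} {C : ℝ≥0} (hg : LipschitzWith C g) {γ : T → E} {θ : T}
    {D : T →L[ℝ] E} {B : T →L[ℝ] F} (hγ : HasFDerivAt γ D θ)
    (hB : HasFDerivAt (fun w => g (γ w)) B θ) : HasFDerivAt (fun w => g (γ θ + D w)) B 0 := by
  rw [hasFDerivAt_iff_isLittleO_nhds_zero] at hγ hB ⊢
  have hO : (fun w => g (γ (θ + w)) - g (γ θ + D w)) =O[𝓝 0] fun w => γ (θ + w) - γ θ - D w := by
    refine Asymptotics.IsBigO.of_bound C (Eventually.of_forall fun w => ?_)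
    rw [sub_sub, ← dist_eq_norm, ← dist_eq_norm]
    exact hg.dist_le_mul _ _
  refine (hB.sub (hO.trans_isLittleO hγ)).congr_left fun w => ?_
  simp only [zero_add, map_zero, add_zero]
  abel

theorem eventually_forall_norm_sub_smul_le {h : T → F} {B : T →L[ℝ] F} (hB : HasFDerivAt h B 0)
    {δ : ℝ} (hδ : 0 < δ) :
    ∀ᶠ t : ℝ in 𝓝[>] 0, ∀ w ∈ closedBall (0 : T) 1, ‖h (t • w) - (h 0 + t • B w)‖ ≤ t * δ := by
  rw [hasFDerivAt_iff_isLittleO_nhds_zero] at hB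
  obtain ⟨ρ, hρ, hsmall⟩ := Metric.eventually_nhds_iff.1 (hB.def hδ)
  filter_upwards [Ioo_mem_nhdsGT hρ] with t ⟨ht, htρ⟩ w hw
  have htw : ‖t • w‖ ≤ t := by
    rw [norm_smul, Real.norm_of_nonneg ht.le]
    exact mul_le_of_le_one_right ht.le (mem_closedBall_zero_iff.1 hw)
  have := hsmall (y := t • w) (by rw [dist_zero_right]; exact htw.trans_lt htρ)
  rw [zero_add, map_smul, sub_sub] at this
  exact this.trans ((mul_le_mul_of_nonneg_left htw hδ.le).trans_eq (mul_comm _ _))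

variable [FiniteDimensional ℝ T] [FiniteDimensional ℝ E] [FiniteDimensional ℝ F]
  {g : E → F} {C : ℝ≥0} {p : E} {D : T →L[ℝ] E} {B : T →L[ℝ] F}

theorem exists_mem_convexHull_norm_comp_sub_le_mul [MeasurableSpace T] [BorelSpace T]
    (μ : Measure T) [μ.IsAddHaarMeasure] {b : ContDiffBump (0 : T)} (hb : b.rOut = 1)
    (hg : LipschitzWith C g) (hB : HasFDerivAt (fun w => g (p + D w)) B 0) {r δ : ℝ} (hr : 0 < r)
    (hδ : 0 < δ) :
    ∃ A ∈ convexHull ℝ (closure (derivNear g p r)),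
      ‖A.comp D - B‖ ≤ δ * ∫ w, ‖fderiv ℝ (b.normed μ) w‖ ∂μ := by
  borelize E
  have htD : Tendsto (fun t : ℝ => t * ‖D‖) (𝓝[>] 0) (𝓝 0) :=
    ((continuous_mul_const ‖D‖).tendsto' 0 0 (zero_mul _)).mono_left nhdsWithin_le_nhds
  obtain ⟨t, ⟨htr, hsmall⟩, ht⟩ := (((htD.eventually_lt_const (half_pos hr)).and
    (eventually_forall_norm_sub_smul_le hB (half_pos hδ))).and self_mem_nhdsWithin).exists
  replace ht : 0 < t := ht
  obtain ⟨z, hz, hdiff⟩ := exists_ae_differentiableAt_add hg (ν := μ) (q := fun w => p + (t • D) w)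
    (by fun_prop) (ρ := min (r / 2) (t * (δ / 2) / (C + 1))) (by positivity)
  obtain ⟨hzr, hzC⟩ := lt_min_iff.1 hz
  rw [lt_div_iff₀ (by positivity)] at hzC
  have hball : ∀ w ∈ closedBall (0 : T) b.rOut, p + z + (t • D) w ∈ ball p r := fun w hw => by
    rw [hb, mem_closedBall_zero_iff] at hw
    have htDw : ‖(t • D) w‖ ≤ t * ‖D‖ := by
      refine ((t • D).le_of_opNorm_le_of_le (norm_smul_le t D) hw).trans_eq ?_
      rw [Real.norm_of_nonneg ht.le, mul_one]
    rw [mem_ball, dist_eq_norm, add_assoc, add_sub_cancel_left]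
    linarith [norm_add_le z ((t • D) w)]
  have hclose : ∀ w ∈ closedBall (0 : T) b.rOut,
      ‖g (p + z + (t • D) w) - (g p + (t • B) w)‖ ≤ t * δ := fun w hw => by
    have hshift : ‖g (p + z + (t • D) w) - g (p + D (t • w))‖ ≤ C * ‖z‖ := by
      rw [smul_apply, ← map_smul, add_right_comm]
      simpa only [add_sub_cancel_left] using hg.norm_sub_le (p + D (t • w) + z) (p + D (t • w))
    have hray : ‖g (p + D (t • w)) - (g p + (t • B) w)‖ ≤ t * (δ / 2) := by
      simpa only [map_zero, add_zero, smul_apply] using hsmall w (hb ▸ hw)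
    linarith [norm_sub_le_norm_sub_add_norm_sub (g (p + z + (t • D) w)) (g (p + D (t • w)))
      (g p + (t • B) w), norm_nonneg z]
  obtain ⟨A, hA, hAD⟩ := exists_mem_convexHull_norm_comp_sub_le_of_close μ hg b (mul_pos ht hδ).le
    (by simpa only [add_right_comm] using hdiff) hball hclose
  refine ⟨A, hA, le_of_mul_le_mul_left ?_ ht⟩
  rwa [ContinuousLinearMap.comp_smul, ← smul_sub, norm_smul, Real.norm_of_nonneg ht.le,
    mul_assoc] at hAD

theorem exists_mem_convexHull_derivNear_norm_comp_sub_le (hg : LipschitzWith C g)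
    (hB : HasFDerivAt (fun w => g (p + D w)) B 0) {r ε : ℝ} (hr : 0 < r) (hε : 0 < ε) :
    ∃ A ∈ convexHull ℝ (closure (derivNear g p r)), ‖A.comp D - B‖ ≤ ε := by
  borelize T
  let μ : Measure T := Measure.addHaar
  let b : ContDiffBump (0 : T) := ⟨1 / 2, 1, by norm_num, by norm_num⟩
  set I := ∫ w, ‖fderiv ℝ (b.normed μ) w‖ ∂μ
  have : 0 ≤ I := integral_nonneg fun _ => norm_nonneg _
  have hεI : ε / (I + 1) * I ≤ ε := by
    rw [div_mul_eq_mul_div, div_le_iff₀ (by positivity)]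
    exact mul_le_mul_of_nonneg_left (by linarith) hε.le
  obtain ⟨A, hA, hAD⟩ := exists_mem_convexHull_norm_comp_sub_le_mul μ (b := b) rfl hg hB hr
    (δ := ε / (I + 1)) (by positivity)
  exact ⟨A, hA, hAD.trans hεI⟩

theorem exists_mem_clarkeJacobian_comp_eq (hg : LipschitzWith C g)
    (hB : HasFDerivAt (fun w => g (p + D w)) B 0) : ∃ A ∈ clarkeJacobian g p, A.comp D = B := by
  let K (n : ℕ) : Set (E →L[ℝ] F) :=
    convexHull ℝ (closure (derivNear g p (1 / ((n : ℝ) + 1)))) ∩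
      {A | ‖A.comp D - B‖ ≤ 1 / ((n : ℝ) + 1)}
  have hKc (n : ℕ) : IsCompact (K n) :=
    (isCompact_convexHull_of_isCompact (isCompact_closure_derivNear hg p _)).inter_right
      (isClosed_le (by fun_prop) continuous_const)
  have hKanti (n : ℕ) : K (n + 1) ⊆ K n := by
    have hn : 1 / (((n + 1 : ℕ) : ℝ) + 1) ≤ 1 / ((n : ℝ) + 1) :=
      Nat.one_div_le_one_div n.le_succ
    exact inter_subset_inter (convexHull_mono (closure_mono (derivNear_mono g p hn)))
      fun A hA => hA.trans hn
  have hKne (n : ℕ) : (K n).Nonempty :=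
    exists_mem_convexHull_derivNear_norm_comp_sub_le hg hB Nat.one_div_pos_of_nat
      Nat.one_div_pos_of_nat
  obtain ⟨A, hA⟩ := IsCompact.nonempty_iInter_of_sequence_nonempty_isCompact_isClosed K hKanti hKne
    (hKc 0) fun n => (hKc n).isClosed
  have hAK (n : ℕ) : A ∈ K n := mem_iInter.1 hA n
  refine ⟨A, mem_clarkeJacobian_of_forall_mem_convexHull hg fun n => (hAK n).1, ?_⟩
  exact sub_eq_zero.1 (norm_le_zero_iff.1
    (ge_of_tendsto' tendsto_one_div_add_atTop_nhds_zero_nat fun n => (hAK n).2))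

theorem exists_mem_clarkeJacobian_comp_eq_of_lipschitzOnWith {f : E → F} {Ω : Set E}
    (hΩ : IsOpen Ω) (hf : LipschitzOnWith C f Ω) {γ : T → E} {θ : T} (hθ : γ θ ∈ Ω)
    (hγ : HasFDerivAt γ D θ) (hB : HasFDerivAt (fun w => f (γ w)) B θ) :
    ∃ A ∈ clarkeJacobian f (γ θ), A.comp D = B := by
  obtain ⟨g, hg, hfg⟩ := hf.extend_finite_dimension
  have hev : f =ᶠ[𝓝 (γ θ)] g := hfg.eventuallyEq_of_mem (hΩ.mem_nhds hθ)
  have hB' : HasFDerivAt (fun w => g (γ w)) B θ :=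
    hB.congr_of_eventuallyEq (hγ.continuousAt.eventually hev.symm)
  obtain ⟨A, hA, hAD⟩ := exists_mem_clarkeJacobian_comp_eq hg (hasFDerivAt_comp_tangent hg hγ hB')
  exact ⟨A, clarkeJacobian_subset_of_eventuallyEq hev.symm hA, hAD⟩

end Tangential

section ChainRule

/-- The values at `p` allowed for a pointwise version of the Jacobian of `f` in the sense of
`IsJacobianVersion`: Clarke's generalized Jacobian, cut down to the derivative where it exists. -/
def admissibleJacobians {E F : Type*} [NormedAddCommGroup E] [NormedSpace ℝ E]
    [NormedAddCommGroup F] [NormedSpace ℝ F] (f : E → F) (p : E) : Set (E →L[ℝ] F) :=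
  {A ∈ clarkeJacobian f p | DifferentiableAt ℝ f p → A = fderiv ℝ f p}

variable {E T F : Type*} [NormedAddCommGroup E] [NormedSpace ℝ E] [FiniteDimensional ℝ E]
  [NormedAddCommGroup T] [NormedSpace ℝ T] [FiniteDimensional ℝ T]
  [NormedAddCommGroup F] [NormedSpace ℝ F] [FiniteDimensional ℝ F]
  {f : E → F} {Ω : Set E} {L : ℝ≥0}

theorem exists_mem_admissibleJacobians_comp_fderiv_eq (hΩ : IsOpen Ω) (hf : LipschitzOnWith L f Ω)
    {γ : T → E} {θ : T} (hθ : γ θ ∈ Ω) (hγ : DifferentiableAt ℝ γ θ)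
    (hfγ : DifferentiableAt ℝ (fun θ => f (γ θ)) θ) :
    ∃ A ∈ admissibleJacobians f (γ θ),
      A.comp (fderiv ℝ γ θ) = fderiv ℝ (fun θ => f (γ θ)) θ := by
  by_cases hd : DifferentiableAt ℝ f (γ θ)
  · exact ⟨fderiv ℝ f (γ θ), ⟨fderiv_mem_clarkeJacobian hd, fun _ => rfl⟩,
      (fderiv_comp θ hd hγ).symm⟩
  · obtain ⟨A, hA, hAγ⟩ := exists_mem_clarkeJacobian_comp_eq_of_lipschitzOnWith hΩ hf hθ
      hγ.hasFDerivAt hfγ.hasFDerivAt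
    exact ⟨A, ⟨hA, fun h => absurd h hd⟩, hAγ⟩

theorem admissibleJacobians_nonempty (hΩ : IsOpen Ω) (hf : LipschitzOnWith L f Ω) {p : E}
    (hp : p ∈ Ω) : (admissibleJacobians f p).Nonempty :=
  let ⟨A, hA, _⟩ := exists_mem_admissibleJacobians_comp_fderiv_eq (T := ℝ) (γ := fun _ => p)
    (θ := 0) hΩ hf hp (differentiableAt_const p) (differentiableAt_const (f p))
  ⟨A, hA⟩

variable [MeasureSpace E] [BorelSpace E] [(volume : Measure E).IsAddHaarMeasure]

theorem isJacobianVersion_of_forall_mem_admissibleJacobians (hΩ : IsOpen Ω)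
    (hf : LipschitzOnWith L f Ω) {J : E → E →L[ℝ] F}
    (hJ : ∀ p ∈ Ω, J p ∈ admissibleJacobians f p) : IsJacobianVersion f Ω J where
  isWeakJacobian := by
    refine (isWeakJacobian_fderiv_of_lipschitzOnWith hΩ hf).congr_ae ?_
    filter_upwards [ae_differentiableAt_of_lipschitzOnWith volume hΩ hf,
      ae_restrict_mem hΩ.measurableSet] with p hd hp using ((hJ p hp).2 hd).symm
  eq_fderiv p hp := (hJ p hp).2
  mem_clarkeJacobian p hp := (hJ p hp).1

variable [MeasurableSpace T] [BorelSpace T] {Θ : Set T} {ι : Type*} [Countable ι] {γ : ι → T → E}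

theorem ae_forall_fderiv_eq_of_eq (μ : Measure T) [μ.IsAddHaarMeasure] (γ : ι → T → F) (i : ι) :
    ∀ᵐ θ ∂μ, ∀ j, γ j θ = γ i θ → DifferentiableAt ℝ (γ j) θ → DifferentiableAt ℝ (γ i) θ →
      fderiv ℝ (γ j) θ = fderiv ℝ (γ i) θ :=
  ae_all_iff.2 fun j => ae_fderiv_eq_of_eq μ (γ j) (γ i)

theorem ae_forall_differentiableAt_of_lipschitzOnWith (μ : Measure T) [μ.IsAddHaarMeasure]
    {γ : ι → T → F} (hΘ : IsOpen Θ) (hγ : ∀ i, ∃ M : ℝ≥0, LipschitzOnWith M (γ i) Θ) :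
    ∀ᵐ θ ∂(μ.restrict Θ), ∀ i, DifferentiableAt ℝ (γ i) θ :=
  ae_all_iff.2 fun i =>
    let ⟨_, hM⟩ := hγ i
    ae_differentiableAt_of_lipschitzOnWith μ hΘ hM

theorem exists_isJacobianVersion_comp_fderiv_eq (hΩ : IsOpen Ω) (hf : LipschitzOnWith L f Ω)
    (μ : Measure T) [μ.IsAddHaarMeasure] (hΘ : IsOpen Θ) {π : E → T}
    (hγ : ∀ i, ∃ M : ℝ≥0, LipschitzOnWith M (γ i) Θ) (hγΩ : ∀ i, MapsTo (γ i) Θ Ω)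
    (hπ : ∀ i, ∀ θ ∈ Θ, π (γ i θ) = θ) :
    ∃ J, IsJacobianVersion f Ω J ∧ ∀ i, ∀ᵐ θ ∂(μ.restrict Θ),
      fderiv ℝ (fun θ => f (γ i θ)) θ = (J (γ i θ)).comp (fderiv ℝ (γ i) θ) := by
  let Compatible (p : E) (A : E →L[ℝ] F) : Prop := ∀ i, γ i (π p) = p →
    A.comp (fderiv ℝ (γ i) (π p)) = fderiv ℝ (fun θ => f (γ i θ)) (π p)
  have hselect : ∀ p ∈ Ω, ∃ A ∈ admissibleJacobians f p,
      (∃ A' ∈ admissibleJacobians f p, Compatible p A') → Compatible p A := fun p hp => by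
    by_cases h : ∃ A' ∈ admissibleJacobians f p, Compatible p A'
    · obtain ⟨A, hA, hAp⟩ := h
      exact ⟨A, hA, fun _ => hAp⟩
    · obtain ⟨A, hA⟩ := admissibleJacobians_nonempty hΩ hf hp
      exact ⟨A, hA, fun h' => absurd h' h⟩
  choose! J hJ hJcompat using hselect
  refine ⟨J, isJacobianVersion_of_forall_mem_admissibleJacobians hΩ hf hJ, fun i => ?_⟩
  have hfγ (j : ι) : ∃ M : ℝ≥0, LipschitzOnWith M (fun θ => f (γ j θ)) Θ :=
    let ⟨_, hM⟩ := hγ j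
    ⟨_, hf.comp hM (hγΩ j)⟩
  filter_upwards [ae_forall_differentiableAt_of_lipschitzOnWith μ hΘ hγ,
    ae_forall_differentiableAt_of_lipschitzOnWith μ hΘ hfγ,
    ae_restrict_of_ae (ae_forall_fderiv_eq_of_eq μ γ i),
    ae_restrict_of_ae (ae_forall_fderiv_eq_of_eq μ (fun j θ => f (γ j θ)) i),
    ae_restrict_mem hΘ.measurableSet] with θ hdγ hdfγ hγeq hfγeq hθ
  obtain ⟨A, hA, hAi⟩ := exists_mem_admissibleJacobians_comp_fderiv_eq hΩ hf (hγΩ i hθ) (hdγ i)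
    (hdfγ i)
  have hAcompat : Compatible (γ i θ) A := fun j hj => by
    rw [hπ i θ hθ] at hj ⊢
    rw [hγeq j hj (hdγ j) (hdγ i), hfγeq j (congrArg f hj) (hdfγ j) (hdfγ i), hAi]
  have hJi := hJcompat (γ i θ) (hγΩ i hθ) ⟨A, hA, hAcompat⟩ i
  rw [hπ i θ hθ] at hJi
  exact (hJi rfl).symm

end ChainRule

section GraphChainRule

variable {E T F : Type*} [NormedAddCommGroup E] [NormedSpace ℝ E]
  [NormedAddCommGroup T] [NormedSpace ℝ T] [NormedAddCommGroup F] [NormedSpace ℝ F]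

theorem comp_prod_id_eq (A : E × T →L[ℝ] F) (D : T →L[ℝ] E) :
    A.comp (D.prod (.id ℝ T)) = (varBlock A).comp D + paramBlock A := by
  ext v
  simp [varBlock, paramBlock, ← map_add]

variable [FiniteDimensional ℝ E] [MeasureSpace E] [BorelSpace E]
  [(volume : Measure E).IsAddHaarMeasure]
  [FiniteDimensional ℝ T] [MeasureSpace T] [BorelSpace T] [(volume : Measure T).IsAddHaarMeasure]

instance isAddHaarMeasure_volume_prod : (volume : Measure (E × T)).IsAddHaarMeasure :=
  inferInstanceAs (((volume : Measure E).prod (volume : Measure T)).IsAddHaarMeasure)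

variable [FiniteDimensional ℝ F] {Θ : Set T} {f : E × T → F} {L : ℝ≥0}
  {ι : Type*} [Countable ι] {c : ι → T → E}

theorem exists_isJacobianVersion_ae_eq_varBlock_comp_add_paramBlock (hΘ : IsOpen Θ)
    (hf : LipschitzOnWith L f (univ ×ˢ Θ)) (hc : ∀ i, ∃ M : ℝ≥0, LipschitzOnWith M (c i) Θ) :
    ∃ J, IsJacobianVersion f (univ ×ˢ Θ) J ∧
      ∀ (i : ι) (Jc : T → T →L[ℝ] E) (Jfc : T → T →L[ℝ] F), IsWeakJacobian (c i) Θ Jc →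
        IsWeakJacobian (fun θ => f (c i θ, θ)) Θ Jfc → ∀ᵐ θ ∂(volume.restrict Θ),
          Jfc θ = (varBlock (J (c i θ, θ))).comp (Jc θ) + paramBlock (J (c i θ, θ)) := by
  have hgraph (i : ι) : ∃ M : ℝ≥0, LipschitzOnWith M (fun θ => (c i θ, θ)) Θ :=
    let ⟨_, hM⟩ := hc i
    ⟨_, hM.prodMk LipschitzWith.id.lipschitzOnWith⟩
  have hmaps (i : ι) : MapsTo (fun θ => (c i θ, θ)) Θ (univ ×ˢ Θ) := fun θ hθ => ⟨mem_univ _, hθ⟩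
  obtain ⟨J, hJ, hchain⟩ := exists_isJacobianVersion_comp_fderiv_eq (isOpen_univ.prod hΘ) hf volume
    hΘ (π := Prod.snd) hgraph hmaps fun _ _ _ => rfl
  refine ⟨J, hJ, fun i Jc Jfc hJc hJfc => ?_⟩
  obtain ⟨M, hM⟩ := hc i
  obtain ⟨N, hN⟩ := hgraph i
  filter_upwards [hchain i, hJc.ae_eq_fderiv hΘ hM, hJfc.ae_eq_fderiv hΘ (hf.comp hN (hmaps i)),
    ae_differentiableAt_of_lipschitzOnWith volume hΘ hM] with θ hθ hJcθ hJfcθ hd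
  rw [hJcθ, hJfcθ, ← comp_prod_id_eq, ← (hd.hasFDerivAt.prodMk (hasFDerivAt_id θ)).fderiv]
  exact hθ

end GraphChainRule

section LipschitzFamily

variable {A B T : Type*} [PseudoMetricSpace A] [PseudoMetricSpace B] [PseudoMetricSpace T]
  {Θ : Set T} {L : ℝ≥0}

theorem lipschitzOnWith_uncurry {f : A → T → B} {M : ℝ≥0}
    (hA : ∀ θ ∈ Θ, LipschitzWith L fun a => f a θ) (hT : ∀ a, LipschitzOnWith M (f a) Θ) :
    LipschitzOnWith (L + M) (fun p : A × T => f p.1 p.2) (univ ×ˢ Θ) :=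
  LipschitzOnWith.of_dist_le_mul fun p hp q hq => by
    calc dist (f p.1 p.2) (f q.1 q.2)
        ≤ dist (f p.1 p.2) (f q.1 p.2) + dist (f q.1 p.2) (f q.1 q.2) := dist_triangle _ _ _
      _ ≤ L * dist p.1 q.1 + M * dist p.2 q.2 :=
        add_le_add ((hA p.2 hp.2).dist_le_mul _ _) ((hT q.1).dist_le_mul _ hp.2 _ hq.2)
      _ ≤ L * dist p q + M * dist p q := by
        gcongr
        exacts [le_max_left _ _, le_max_right _ _]
      _ = ↑(L + M) * dist p q := by push_cast; ring

theorem exists_lipschitzOnWith_orbit {f : A × T → A} {c : ℕ → T → A}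
    (hf : LipschitzOnWith L f (univ ×ˢ Θ)) (hc : ∀ n θ, c (n + 1) θ = f (c n θ, θ))
    (h0 : ∃ M : ℝ≥0, LipschitzOnWith M (c 0) Θ) (n : ℕ) :
    ∃ M : ℝ≥0, LipschitzOnWith M (c n) Θ := by
  induction n with
  | zero => exact h0
  | succ n ih =>
    obtain ⟨M, hM⟩ := ih
    rw [funext (hc n)]
    exact ⟨_, hf.comp (hM.prodMk LipschitzWith.id.lipschitzOnWith) fun θ hθ => ⟨mem_univ _, hθ⟩⟩

end LipschitzFamily

section Algorithm

variable {X U Y T : Type*} [NormedAddCommGroup X] [InnerProductSpace ℝ X]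
  [NormedAddCommGroup U] [InnerProductSpace ℝ U] {K : X →L[ℝ] U}
  {H : X → Y → T → EReal} {G : U → Y → T → EReal} {y : Y} {τ ξ ζ : ℝ}

theorem fderiv_output (a : X × X × U) :
    fderiv ℝ output a = ContinuousLinearMap.fst ℝ X (X × U) :=
  fderiv_fst

theorem exists_lipschitzWith_dualPoint (τ : ℝ) (K : X →L[ℝ] U) :
    ∃ M : ℝ≥0, LipschitzWith M (dualPoint τ K) :=
  ⟨_, (LipschitzWith.prod_snd.comp LipschitzWith.prod_snd).add
    ((τ • K).lipschitz.comp (LipschitzWith.prod_fst.comp LipschitzWith.prod_snd))⟩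

theorem exists_lipschitzOnWith_dualPoint_comp [PseudoMetricSpace T] {Θ : Set T} (τ : ℝ)
    (K : X →L[ℝ] U) {a : T → X × X × U} (ha : ∃ M : ℝ≥0, LipschitzOnWith M a Θ) :
    ∃ M : ℝ≥0, LipschitzOnWith M (fun θ => dualPoint τ K (a θ)) Θ :=
  let ⟨_, hM⟩ := ha
  let ⟨_, hN⟩ := exists_lipschitzWith_dualPoint τ K
  ⟨_, hN.comp_lipschitzOnWith hM⟩

theorem lipschitzWith_proxPrimal [FiniteDimensional ℝ X] {θ : T} (hξ : 0 < ξ)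
    (hH : IsProperClosedConvex fun x => H x y θ) :
    LipschitzWith 1 fun x => proxPrimal ξ H x y θ :=
  (hH.const_mul hξ).lipschitzWith_prox

theorem lipschitzWith_proxDual [FiniteDimensional ℝ U] {θ : T} (hτ : 0 < τ)
    (hG : IsProperClosedConvex fun u => G u y θ) :
    LipschitzWith 1 fun u => proxDual τ G u y θ :=
  (hG.conjugate.const_mul hτ).lipschitzWith_prox

variable [CompleteSpace X] [CompleteSpace U]

theorem exists_lipschitzWith_primalPoint (ξ : ℝ) (K : X →L[ℝ] U) :
    ∃ M : ℝ≥0, LipschitzWith M fun p : (X × X × U) × U => primalPoint ξ K p.1 p.2 :=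
  ⟨_, (LipschitzWith.prod_fst.comp LipschitzWith.prod_fst).sub
    ((ξ • ContinuousLinearMap.adjoint K).lipschitz.comp LipschitzWith.prod_snd)⟩

section WeakJacobian

variable {E : Type*} [NormedAddCommGroup E] [NormedSpace ℝ E] [MeasureSpace E] [BorelSpace E]
  {Ω : Set E} {a : E → X × X × U} {Jx : E → E →L[ℝ] X} {Ju : E → E →L[ℝ] U}

theorem IsWeakJacobian.dualPoint_comp (hx : IsWeakJacobian (fun θ => (a θ).2.1) Ω Jx)
    (hu : IsWeakJacobian (fun θ => (a θ).2.2) Ω Ju) :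
    IsWeakJacobian (fun θ => dualPoint τ K (a θ)) Ω fun θ => Ju θ + τ • K.comp (Jx θ) :=
  hu.add ((hx.clm_comp K).const_smul τ)

theorem IsWeakJacobian.primalPoint_comp {u : E → U}
    (hx : IsWeakJacobian (fun θ => (a θ).1) Ω Jx) (hu : IsWeakJacobian u Ω Ju) :
    IsWeakJacobian (fun θ => primalPoint ξ K (a θ) (u θ)) Ω
      fun θ => Jx θ - ξ • (ContinuousLinearMap.adjoint K).comp (Ju θ) :=
  hx.sub ((hu.clm_comp (ContinuousLinearMap.adjoint K)).const_smul ξ)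

end WeakJacobian

variable [PseudoMetricSpace T] {Θ : Set T}

theorem exists_lipschitzOnWith_primalPoint_comp (ξ : ℝ) (K : X →L[ℝ] U) {a : T → X × X × U}
    {u : T → U} (ha : ∃ M : ℝ≥0, LipschitzOnWith M a Θ) (hu : ∃ M : ℝ≥0, LipschitzOnWith M u Θ) :
    ∃ M : ℝ≥0, LipschitzOnWith M (fun θ => primalPoint ξ K (a θ) (u θ)) Θ :=
  let ⟨_, hM⟩ := ha
  let ⟨_, hM'⟩ := hu
  let ⟨_, hN⟩ := exists_lipschitzWith_primalPoint ξ K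
  ⟨_, hN.comp_lipschitzOnWith (hM.prodMk hM')⟩

theorem lipschitzOnWith_proxDual_of_step {L : ℝ≥0}
    (hstep : ∀ a, LipschitzOnWith L (fun θ => step τ ξ ζ K H G a y θ) Θ) (u : U) :
    LipschitzOnWith L (fun θ => proxDual τ G u y θ) Θ := by
  have hu := LipschitzWith.prod_snd.comp_lipschitzOnWith
    (LipschitzWith.prod_snd.comp_lipschitzOnWith (hstep (0, 0, u)))
  simpa [Function.comp_def, step, dualPoint] using hu

theorem exists_lipschitzOnWith_proxPrimal_of_step [FiniteDimensional ℝ X] {L : ℝ≥0} (hξ : 0 < ξ)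
    (hH : ∀ θ ∈ Θ, IsProperClosedConvex fun x => H x y θ)
    (hstep : ∀ a, LipschitzOnWith L (fun θ => step τ ξ ζ K H G a y θ) Θ) :
    ∃ M : ℝ≥0, ∀ x, LipschitzOnWith M (fun θ => proxPrimal ξ H x y θ) Θ := by
  set S : U →L[ℝ] X := ξ • ContinuousLinearMap.adjoint K with hS
  set u : T → U := fun θ => proxDual τ G 0 y θ with hu
  refine ⟨L + ‖S‖₊ * L, fun x => LipschitzOnWith.of_dist_le_mul fun θ hθ θ' hθ' => ?_⟩
  -- The step from `(x + S (u θ), 0, 0)` at the parameter `θ` evaluates the primal proximity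
  -- operator exactly at `x`.
  have hstep_fst (η : T) : (step τ ξ ζ K H G (x + S (u θ), 0, 0) y η).1 =
      proxPrimal ξ H (x + S (u θ) - S (u η)) y η := by
    simp [step, dualPoint, primalPoint, hS, hu]
  have hmove : dist (proxPrimal ξ H x y θ) (proxPrimal ξ H (x + S (u θ) - S (u θ')) y θ') ≤
      L * dist θ θ' := by
    simpa [hstep_fst] using (LipschitzWith.prod_fst.comp_lipschitzOnWith
      (hstep (x + S (u θ), 0, 0))).dist_le_mul θ hθ θ' hθ'
  have hreturn : dist (proxPrimal ξ H (x + S (u θ) - S (u θ')) y θ') (proxPrimal ξ H x y θ') ≤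
      ‖S‖₊ * (L * dist θ θ') :=
    calc dist (proxPrimal ξ H (x + S (u θ) - S (u θ')) y θ') (proxPrimal ξ H x y θ')
        ≤ dist (x + S (u θ) - S (u θ')) x :=
          ((lipschitzWith_proxPrimal hξ (hH θ' hθ')).dist_le_mul _ _).trans_eq (one_mul _)
      _ = dist (S (u θ)) (S (u θ')) := by simp
      _ ≤ ‖S‖₊ * dist (u θ) (u θ') := S.lipschitz.dist_le_mul _ _
      _ ≤ ‖S‖₊ * (L * dist θ θ') := by
          gcongr
          exact (lipschitzOnWith_proxDual_of_step hstep 0).dist_le_mul θ hθ θ' hθ'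
  calc dist (proxPrimal ξ H x y θ) (proxPrimal ξ H x y θ')
      ≤ L * dist θ θ' + ‖S‖₊ * (L * dist θ θ') :=
        (dist_triangle _ _ _).trans (add_le_add hmove hreturn)
    _ = ↑(L + ‖S‖₊ * L) * dist θ θ' := by push_cast; ring

theorem exists_lipschitzOnWith_uncurry_proxDual [FiniteDimensional ℝ U] {L : ℝ≥0} (hτ : 0 < τ)
    (hG : ∀ θ ∈ Θ, IsProperClosedConvex fun u => G u y θ)
    (hstep : ∀ a, LipschitzOnWith L (fun θ => step τ ξ ζ K H G a y θ) Θ) :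
    ∃ M : ℝ≥0, LipschitzOnWith M (fun p : U × T => proxDual τ G p.1 y p.2) (univ ×ˢ Θ) :=
  ⟨_, lipschitzOnWith_uncurry (fun θ hθ => lipschitzWith_proxDual hτ (hG θ hθ))
    (lipschitzOnWith_proxDual_of_step hstep)⟩

theorem exists_lipschitzOnWith_uncurry_proxPrimal [FiniteDimensional ℝ X] {L : ℝ≥0} (hξ : 0 < ξ)
    (hH : ∀ θ ∈ Θ, IsProperClosedConvex fun x => H x y θ)
    (hstep : ∀ a, LipschitzOnWith L (fun θ => step τ ξ ζ K H G a y θ) Θ) :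
    ∃ M : ℝ≥0, LipschitzOnWith M (fun p : X × T => proxPrimal ξ H p.1 y p.2) (univ ×ˢ Θ) :=
  let ⟨_, hM⟩ := exists_lipschitzOnWith_proxPrimal_of_step hξ hH hstep
  ⟨_, lipschitzOnWith_uncurry (fun θ hθ => lipschitzWith_proxPrimal hξ (hH θ hθ)) hM⟩

theorem exists_lipschitzOnWith_step
    (hG : ∃ M : ℝ≥0, LipschitzOnWith M (fun p : U × T => proxDual τ G p.1 y p.2) (univ ×ˢ Θ))
    (hH : ∃ M : ℝ≥0, LipschitzOnWith M (fun p : X × T => proxPrimal ξ H p.1 y p.2) (univ ×ˢ Θ)) :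
    ∃ L : ℝ≥0, LipschitzOnWith L
      (fun p : (X × X × U) × T => step τ ξ ζ K H G p.1 y p.2) (univ ×ˢ Θ) := by
  obtain ⟨M, hM⟩ := hG
  obtain ⟨N, hN⟩ := hH
  have hfst : LipschitzOnWith 1 (Prod.fst : (X × X × U) × T → X × X × U) (univ ×ˢ Θ) :=
    LipschitzWith.prod_fst.lipschitzOnWith
  have hsnd : LipschitzOnWith 1 (Prod.snd : (X × X × U) × T → T) (univ ×ˢ Θ) :=
    LipschitzWith.prod_snd.lipschitzOnWith
  obtain ⟨D, hD⟩ := exists_lipschitzOnWith_dualPoint_comp τ K ⟨1, hfst⟩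
  have hu := hM.comp (hD.prodMk hsnd) fun p hp => ⟨mem_univ _, hp.2⟩
  obtain ⟨P, hP⟩ := exists_lipschitzOnWith_primalPoint_comp ξ K ⟨1, hfst⟩ ⟨_, hu⟩
  have hx := hN.comp (hP.prodMk hsnd) fun p hp => ⟨mem_univ _, hp.2⟩
  exact ⟨_, hx.prodMk ((hx.add ((lipschitzWith_smul ζ).comp_lipschitzOnWith
    (hx.sub (LipschitzWith.prod_fst.comp_lipschitzOnWith hfst)))).prodMk hu)⟩

end Algorithm

end PrimalDual

theorem mainTheorem11
    {X U Y T : Type*}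
    [NormedAddCommGroup X] [InnerProductSpace ℝ X] [CompleteSpace X] [FiniteDimensional ℝ X]
    [MeasurableSpace X] [BorelSpace X]
    [NormedAddCommGroup U] [InnerProductSpace ℝ U] [CompleteSpace U] [FiniteDimensional ℝ U]
    [MeasurableSpace U] [BorelSpace U]
    [NormedAddCommGroup T] [InnerProductSpace ℝ T] [FiniteDimensional ℝ T]
    [MeasurableSpace T] [BorelSpace T]
    (Θ : Set T) (hΘ : IsOpen Θ)
    (τ ξ ζ : ℝ) (hτ : 0 < τ) (hξ : 0 < ξ)
    (K : X →L[ℝ] U) (H : X → Y → T → EReal) (G : U → Y → T → EReal)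
    (a₀ : Y → T → X × X × U) (y : Y)
    (hH : ∀ θ ∈ Θ, PrimalDual.IsProperClosedConvex (fun x => H x y θ))
    (hG : ∀ θ ∈ Θ, PrimalDual.IsProperClosedConvex (fun u => G u y θ))
    -- the iteration map is Lipschitz in `θ`, uniformly in `a`, and so is the initial point
    (hstep : ∃ L : ℝ≥0, ∀ a : X × X × U,
      LipschitzOnWith L (fun θ => PrimalDual.step τ ξ ζ K H G a y θ) Θ)
    (hinit : ∃ L : ℝ≥0, LipschitzOnWith L (fun θ => a₀ y θ) Θ) :
    -- all iterates are weakly differentiable in `θ`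
    (∀ ℓ : ℕ,
      PrimalDual.IsWeaklyDifferentiableOn
        (fun θ => PrimalDual.iter τ ξ ζ K H G a₀ ℓ y θ) Θ ∧
      PrimalDual.IsWeaklyDifferentiableOn
        (fun θ => (PrimalDual.iter τ ξ ζ K H G a₀ ℓ y θ).1) Θ ∧
      PrimalDual.IsWeaklyDifferentiableOn
        (fun θ => (PrimalDual.iter τ ξ ζ K H G a₀ ℓ y θ).2.1) Θ ∧
      PrimalDual.IsWeaklyDifferentiableOn
        (fun θ => (PrimalDual.iter τ ξ ζ K H G a₀ ℓ y θ).2.2) Θ) ∧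
    -- Jacobians of the iteration map and of the two proximity operators in (variable, `θ`)
    ∃ (JΨ : (X × X × U) × T → (X × X × U) × T →L[ℝ] X × X × U)
      (JG : U × T → U × T →L[ℝ] U) (JH : X × T → X × T →L[ℝ] X),
      PrimalDual.IsJacobianVersion
        (fun p : (X × X × U) × T => PrimalDual.step τ ξ ζ K H G p.1 y p.2) (univ ×ˢ Θ) JΨ ∧
      PrimalDual.IsJacobianVersion
        (fun p : U × T => PrimalDual.proxDual τ G p.1 y p.2) (univ ×ˢ Θ) JG ∧
      PrimalDual.IsJacobianVersion
        (fun p : X × T => PrimalDual.proxPrimal ξ H p.1 y p.2) (univ ×ˢ Θ) JH ∧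
      -- whatever the versions of the weak Jacobians of the iterates
      ∀ (Ja : ℕ → T → T →L[ℝ] X × X × U) (Jx Jxt : ℕ → T → T →L[ℝ] X) (Ju : ℕ → T → T →L[ℝ] U),
        (∀ ℓ, PrimalDual.IsWeakJacobian
          (fun θ => PrimalDual.iter τ ξ ζ K H G a₀ ℓ y θ) Θ (Ja ℓ)) →
        (∀ ℓ, PrimalDual.IsWeakJacobian
          (fun θ => (PrimalDual.iter τ ξ ζ K H G a₀ ℓ y θ).1) Θ (Jx ℓ)) →
        (∀ ℓ, PrimalDual.IsWeakJacobian
          (fun θ => (PrimalDual.iter τ ξ ζ K H G a₀ ℓ y θ).2.1) Θ (Jxt ℓ)) →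
        (∀ ℓ, PrimalDual.IsWeakJacobian
          (fun θ => (PrimalDual.iter τ ξ ζ K H G a₀ ℓ y θ).2.2) Θ (Ju ℓ)) →
        ∀ ℓ : ℕ, ∀ᵐ θ ∂(volume.restrict Θ),
          let a := PrimalDual.iter τ ξ ζ K H G a₀ ℓ y θ
          let u' := (PrimalDual.iter τ ξ ζ K H G a₀ (ℓ + 1) y θ).2.2
          let dU := PrimalDual.dualPoint τ K a
          let pX := PrimalDual.primalPoint ξ K a u'
          let JU := Ju ℓ θ + τ • K.comp (Jxt ℓ θ)
          let JX := Jx ℓ θ - ξ • (ContinuousLinearMap.adjoint K).comp (Ju (ℓ + 1) θ)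
          Jx ℓ θ = (fderiv ℝ PrimalDual.output a).comp (Ja ℓ θ) ∧
          Ja (ℓ + 1) θ = (PrimalDual.varBlock (JΨ (a, θ))).comp (Ja ℓ θ) +
            PrimalDual.paramBlock (JΨ (a, θ)) ∧
          Ju (ℓ + 1) θ = (PrimalDual.varBlock (JG (dU, θ))).comp JU +
            PrimalDual.paramBlock (JG (dU, θ)) ∧
          Jx (ℓ + 1) θ = (PrimalDual.varBlock (JH (pX, θ))).comp JX +
            PrimalDual.paramBlock (JH (pX, θ)) ∧
          Jxt (ℓ + 1) θ = Jx (ℓ + 1) θ + ζ • (Jx (ℓ + 1) θ - Jx ℓ θ) := by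
  open PrimalDual in
  obtain ⟨L, hstep⟩ := hstep
  obtain ⟨M, hLipG⟩ := exists_lipschitzOnWith_uncurry_proxDual hτ hG hstep
  obtain ⟨N, hLipH⟩ := exists_lipschitzOnWith_uncurry_proxPrimal hξ hH hstep
  obtain ⟨P, hLipΨ⟩ := exists_lipschitzOnWith_step (ζ := ζ) (K := K) ⟨M, hLipG⟩ ⟨N, hLipH⟩
  have hiter := exists_lipschitzOnWith_orbit (c := fun ℓ => iter τ ξ ζ K H G a₀ ℓ y) hLipΨ
    (fun _ _ => rfl) hinit
  have hwd ℓ := isWeaklyDifferentiableOn_of_lipschitzOnWith hΘ (hiter ℓ).choose_spec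
  obtain ⟨JΨ, hJΨ, hΨ⟩ :=
    exists_isJacobianVersion_ae_eq_varBlock_comp_add_paramBlock hΘ hLipΨ hiter
  obtain ⟨JG, hJG, hG⟩ := exists_isJacobianVersion_ae_eq_varBlock_comp_add_paramBlock hΘ hLipG
    fun ℓ => exists_lipschitzOnWith_dualPoint_comp τ K (hiter ℓ)
  obtain ⟨JH, hJH, hH⟩ := exists_isJacobianVersion_ae_eq_varBlock_comp_add_paramBlock hΘ hLipH
    fun ℓ => exists_lipschitzOnWith_primalPoint_comp ξ K (hiter ℓ)
      ⟨_, LipschitzWith.prod_snd.comp_lipschitzOnWith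
        (LipschitzWith.prod_snd.comp_lipschitzOnWith (hiter (ℓ + 1)).choose_spec)⟩
  refine ⟨fun ℓ => ⟨hwd ℓ, (hwd ℓ).fst, (hwd ℓ).snd.fst, (hwd ℓ).snd.snd⟩, JΨ, JG, JH, hJΨ, hJG,
    hJH, fun Ja Jx Jxt Ju hJa hJx hJxt hJu ℓ => ?_⟩
  filter_upwards [(hJx ℓ).ae_eq hΘ ((hJa ℓ).clm_comp (.fst ℝ X (X × U))),
    hΨ ℓ _ _ (hJa ℓ) (hJa (ℓ + 1)), hG ℓ _ _ ((hJxt ℓ).dualPoint_comp (hJu ℓ)) (hJu (ℓ + 1)),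
    hH ℓ _ _ ((hJx ℓ).primalPoint_comp (hJu (ℓ + 1))) (hJx (ℓ + 1)),
    (hJxt (ℓ + 1)).ae_eq hΘ ((hJx (ℓ + 1)).add (((hJx (ℓ + 1)).sub (hJx ℓ)).const_smul ζ))]
    with θ hx hΨθ hGθ hHθ hxt
  exact ⟨hx.trans (by rw [fderiv_output]), hΨθ, hGθ, hHθ, hxt⟩
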